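/- Let $p\ge 1$ be an integer. For $h>0$ consider the uniform mesh of $\mathbb{R}$ with elements $K_j=[jh,(j+1)h]$, $j\in\mathbb{Z}$, the space $V_h$ of continuous functions that are polynomials of degree at most $p$ on each $K_j$, its nodes $x_m=mh/p$, $m\in\mathbb{Z}$, and its nodal basis functions $\phi_m\in V_h$, $\phi_m(x_n)=\delta_{mn}$. For a wave number $k>0$ and a penalty parameter $\gamma\in\mathbb{R}$, the bilinear form of the $p$-th order CIP-FEM for the one-dimensional Helmholtz equation $-u''-k^2u=0$ is $$\mathcal{A}_\gamma(u,v)=\int_{\mathbb{R}}u'v'\,dx-k^2\int_{\mathbb{R}}uv\,dx+\sum_{j\in\mathbb{Z}}\gamma h^{2p-1}\,[u^{(p)}]_{jh}\,[v^{(p)}]_{jh},$$ where $[w]_{jh}$ denotes the left limit minus the right limit of $w$ at $jh$. A real number $k_h$ is called a discrete wave number if $\det\mathcal{D}=0$, where $\mathcal{D}$ is the $p\times p$ matrix $$\mathcal{D}_{s,q}=\sum_{m\in\mathbb{Z}}\mathcal{A}_\gamma(\phi_{q+mp},\phi_s)\,e^{\mathbf{i}mk_hh},\qquad 0\le s,q\le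 p-1,$$ of the equations $\mathcal{A}_\gamma(u_h,\phi_s)=0$ for functions $u_h=\sum_j U_j\phi_j$ that satisfy the Bloch wave condition $u_h(x+mh)=e^{\mathbf{i}mk_hh}u_h(x)$ for all $m\in\mathbb{Z}$. **Theorem 3.1.** For every $\gamma\in\mathbb{R}$ there are constants $C_0,C>0$, depending only on $p$ and $\gamma$, such that for all $k,h>0$ with $\frac{kh}{p}\le C_0$ there exists a discrete wave number $k_h>0$ with $$\left|\,|k-k_h|-\frac12\left|\frac{1}{2p+1}\left[\frac{p!}{(2p)!}\right]^2+\gamma\right|k^{2p+1}h^{2p}\right|\le C\,k^{2p+3}h^{2p+2}.$$ Consequently, for the penalty parameter $\gamma=\gamma_0=-\frac{1}{2p+1}\left[\frac{p!}{(2p)!}\right]^2$ there are constants $C_0,C>0$, depending only on $p$, such that for all $k,h>0$ with $\frac{kh}{p}\le C_0$ there exists a discrete wave number $k_h>0$ with $|k-k_h|\le C\,k^{2p+3}h^{2p+2}$. -/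

import Mathlib

open scoped Polynomial

noncomputable section

namespace CIPFEM

/-- The global nodes `x_m = m h / p`, `m ∈ ℤ`, of the `p`-th order finite element space on the
uniform mesh of size `h` of the real line. -/
def node (p : ℕ) (h : ℝ) (m : ℤ) : ℝ := m * h / p

/-- The elements `K_j = [j h, (j + 1) h]`, `j ∈ ℤ`, of the uniform mesh of size `h`. -/
def element (h : ℝ) (j : ℤ) : Set ℝ := Set.Icc (j * h) ((j + 1) * h)

/-- The finite element space `V_h`: the functions in `H¹_loc(ℝ)` that are polynomials of degree
at most `p` on each element. For a piecewise polynomial, being in `H¹_loc(ℝ)` is continuity. -/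
def feSpace (p : ℕ) (h : ℝ) : Set (ℝ → ℝ) :=
  {v | Continuous v ∧ ∀ j : ℤ, ∃ q : ℝ[X], q.natDegree ≤ p ∧ ∀ x ∈ element h j, v x = q.eval x}

/-- The polynomial of degree at most `p` that takes the value `1` at the node `x_m` and `0` at the
other nodes, among the `p + 1` nodes `x_{jp}, …, x_{jp+p}` of the element `K_j`. -/
def localBasis (p : ℕ) (h : ℝ) (m j : ℤ) : ℝ[X] :=
  Lagrange.interpolate (Finset.range (p + 1)) (fun l : ℕ => node p h (j * p + l))
    (fun l : ℕ => if j * p + l = m then (1 : ℝ) else 0)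

/-- The global nodal basis function `φ_m ∈ V_h` at the node `x_m`. -/
def nodalBasis (p : ℕ) (h : ℝ) (m : ℤ) (x : ℝ) : ℝ :=
  (localBasis p h m ⌊x / h⌋).eval x

theorem node_injective {p : ℕ} (hp : 1 ≤ p) {h : ℝ} (hh : 0 < h) :
    Function.Injective (node p h) := by
  intro a b hab
  have hp' : (0 : ℝ) < p := by exact_mod_cast hp
  unfold node at hab
  have h1 : (a : ℝ) * h = b * h := by
    have := congrArg (fun z => z * (p : ℝ)) hab
    simpa [div_mul_cancel₀ _ hp'.ne'] using this
  exact_mod_cast mul_right_cancel₀ hh.ne' h1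

theorem local_injOn {p : ℕ} (hp : 1 ≤ p) {h : ℝ} (hh : 0 < h) (j : ℤ) :
    Set.InjOn (fun l : ℕ => node p h (j * p + l)) (Finset.range (p + 1) : Set ℕ) := by
  intro a _ b _ hab
  have := node_injective hp hh hab
  omega

theorem localBasis_eval_node {p : ℕ} (hp : 1 ≤ p) {h : ℝ} (hh : 0 < h) (m j : ℤ) {l : ℕ}
    (hl : l ≤ p) :
    (localBasis p h m j).eval (node p h (j * p + l)) = if j * p + l = m then 1 else 0 :=
  Lagrange.eval_interpolate_at_node (v := fun l : ℕ => node p h (j * p + l))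
    (fun l : ℕ => if j * p + l = m then (1 : ℝ) else 0) (local_injOn hp hh j)
    (Finset.mem_range.2 (Nat.lt_succ_of_le hl))

theorem nodalBasis_eq_on_element {p : ℕ} (hp : 1 ≤ p) {h : ℝ} (hh : 0 < h) (m j : ℤ) {x : ℝ}
    (hx : x ∈ element h j) : nodalBasis p h m x = (localBasis p h m j).eval x := by
  have hp' : (p : ℝ) ≠ 0 := by
    have : (0 : ℝ) < p := by exact_mod_cast hp
    exact this.ne'
  obtain ⟨h1, h2⟩ := hx
  rcases h2.lt_or_eq with h2 | h2
  · have : ⌊x / h⌋ = j := by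
      rw [Int.floor_eq_iff, le_div_iff₀ hh, div_lt_iff₀ hh]
      exact ⟨h1, h2⟩
    rw [nodalBasis, this]
  · have hf : ⌊x / h⌋ = j + 1 := by
      rw [h2, mul_div_cancel_right₀ _ hh.ne']
      exact_mod_cast Int.floor_intCast (R := ℝ) (j + 1)
    have e1 : x = node p h ((j + 1) * p + (0 : ℕ)) := by
      rw [h2, node]; push_cast; field_simp; ring
    have e2 : x = node p h (j * p + p) := by
      rw [h2, node]; push_cast; field_simp
    have v1 := localBasis_eval_node hp hh m (j + 1) (Nat.zero_le p)
    have v2 := localBasis_eval_node hp hh m j (le_refl p)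
    rw [← e1] at v1
    rw [← e2] at v2
    rw [nodalBasis, hf, v1, v2]
    congr 2
    push_cast
    ring

/-- The nodal basis functions belong to the finite element space. -/
theorem nodalBasis_mem_feSpace {p : ℕ} (hp : 1 ≤ p) {h : ℝ} (hh : 0 < h) (m : ℤ) :
    nodalBasis p h m ∈ feSpace p h := by
  refine ⟨?_, fun j => ⟨localBasis p h m j, ?_, fun x hx =>
    nodalBasis_eq_on_element hp hh m j hx⟩⟩
  · have hc : ∀ j : ℤ, ContinuousOn (nodalBasis p h m) (element h j) := fun j =>
      ((localBasis p h m j).continuous.continuousOn).congr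
        (fun x hx => nodalBasis_eq_on_element hp hh m j hx)
    rw [continuous_iff_continuousAt]
    intro x
    set j : ℤ := ⌊x / h⌋ with hj
    have a1 : (j : ℝ) * h ≤ x := (le_div_iff₀ hh).1 (Int.floor_le _)
    have a2 : x < (j + 1) * h := (div_lt_iff₀ hh).1 (Int.lt_floor_add_one _)
    have hu := (hc (j - 1)).union_of_isClosed (hc j) isClosed_Icc isClosed_Icc
    refine hu.continuousAt (Filter.mem_of_superset
      (Ioo_mem_nhds (a := (j - 1 : ℝ) * h) (b := (j + 1 : ℝ) * h) (by nlinarith) a2) ?_)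
    intro y hy
    rcases le_total y (j * h) with hy' | hy'
    · left
      refine ⟨?_, ?_⟩ <;> push_cast
      · exact hy.1.le
      · simpa using hy'
    · exact Or.inr ⟨hy', hy.2.le⟩
  · have := Lagrange.degree_interpolate_le
      (r := fun l : ℕ => if j * p + l = m then (1 : ℝ) else 0) (local_injOn hp hh j)
    rw [Finset.card_range, Nat.add_sub_cancel] at this
    exact Polynomial.natDegree_le_of_degree_le this

/-- The nodal basis functions satisfy `φ_m(x_n) = δ_{mn}`. -/
theorem nodalBasis_node {p : ℕ} (hp : 1 ≤ p) {h : ℝ} (hh : 0 < h) (m n : ℤ) :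
    nodalBasis p h m (node p h n) = if n = m then 1 else 0 := by
  have hp0 : (0 : ℤ) < p := by exact_mod_cast hp
  have hpr : (0 : ℝ) < p := by exact_mod_cast hp
  have hdiv : n / p * p + n % p = n := by rw [mul_comm]; exact Int.mul_ediv_add_emod n p
  have hlt := Int.emod_lt_of_pos n hp0
  obtain ⟨l, hl⟩ := Int.eq_ofNat_of_zero_le (Int.emod_nonneg n hp0.ne')
  rw [hl] at hdiv hlt
  have hlp : l ≤ p := by omega
  have key := localBasis_eval_node hp hh m (n / p) hlp
  rw [hdiv] at key
  rw [← key]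
  refine nodalBasis_eq_on_element hp hh m (n / p) ?_
  have hn : (n : ℝ) = ((n / p : ℤ) : ℝ) * p + l := by exact_mod_cast hdiv.symm
  have hlr : (l : ℝ) ≤ p := by exact_mod_cast hlp
  have hl0 : (0 : ℝ) ≤ l := Nat.cast_nonneg l
  refine ⟨?_, ?_⟩
  · rw [node, le_div_iff₀ hpr, hn]; nlinarith [mul_nonneg hl0 hh.le]
  · rw [node, div_le_iff₀ hpr, hn]; nlinarith [mul_le_mul_of_nonneg_right hlr hh.le]

/-- The jump of the `p`-th derivative of `u` across the mesh point `j h`: the `p`-th derivative at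
`j h` of the restriction of `u` to the element on the left, minus that of the restriction of `u`
to the element on the right. -/
def jump (p : ℕ) (h : ℝ) (u : ℝ → ℝ) (j : ℤ) : ℝ :=
  iteratedDerivWithin p u (element h (j - 1)) (j * h) -
    iteratedDerivWithin p u (element h j) (j * h)

/-- The penalty term `J(u, v)`. In one dimension the faces are the mesh points `j h`, `j ∈ ℤ`, and
the integral over a face is evaluation. -/
def penalty (p : ℕ) (h γ : ℝ) (u v : ℝ → ℝ) : ℝ :=
  ∑ᶠ j : ℤ, γ * h ^ (2 * p - 1) * (jump p h u j * jump p h v j)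

/-- The Helmholtz form `𝒜(u, v) = (u', v') - k² (u, v)` with the inner product of `L²(ℝ)`. -/
def helmholtzForm (k : ℝ) (u v : ℝ → ℝ) : ℝ :=
  (∫ x : ℝ, deriv u x * deriv v x) - k ^ 2 * ∫ x : ℝ, u x * v x

/-- The CIP-FEM form `𝒜_γ(u, v) = 𝒜(u, v) + J(u, v)`. -/
def cipForm (p : ℕ) (h k γ : ℝ) (u v : ℝ → ℝ) : ℝ :=
  helmholtzForm k u v + penalty p h γ u v

/-- The matrix `𝒟` of the CIP-FEM equations `∑_j 𝒜_γ(φ_j, φ_s) U_j = 0` tested with the nodal basis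
functions at the generating set `x_0, …, x_{p-1}`, for a nodal vector that satisfies the Bloch wave
condition `U_{q + m p} = exp(i m k_h h) U_q` and so is represented by `(U_0, …, U_{p-1})`. -/
def blochMatrix (p : ℕ) (h k γ k_h : ℝ) : Matrix (Fin p) (Fin p) ℂ :=
  Matrix.of fun s q => ∑ᶠ m : ℤ,
    ((cipForm p h k γ (nodalBasis p h ((q : ℕ) + m * p)) (nodalBasis p h (s : ℕ)) : ℝ) : ℂ) *
      Complex.exp (Complex.I * m * k_h * h)

/-- `k_h` is a discrete wave number of the CIP-FEM: the Bloch system `𝒟 U = 0` has determinant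
zero, that is, it has a nontrivial solution. -/
def IsDiscreteWaveNumber (p : ℕ) (h k γ k_h : ℝ) : Prop :=
  (blochMatrix p h k γ k_h).det = 0

/-- The penalty parameter `γ₀ = -1/(2p+1) [p!/(2p)!]²`. -/
def gammaZero (p : ℕ) : ℝ :=
  -(1 / (2 * p + 1) * ((p.factorial : ℝ) / ((2 * p).factorial : ℝ)) ^ 2)

end CIPFEM

end

/-! Put t = kh and θ = k_h h. The Bloch matrix equals h⁻¹E*GE, where E extends nodal values over one
element by the Bloch condition and G is the real symmetric Gram matrix of ∫P'Q' − t²∫PQ + γ(2 − 2cos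
θ)P⁽ᵖ⁾Q⁽ᵖ⁾ on [0,1] (`blochMatrix_eq`). It is Hermitian and continuous in θ, hence singular
somewhere between a phase at which it is positive definite and a phase at which it takes a negative
value. No determinant is computed: it suffices to find two such phases within O(t^(2p+3)) of the
predicted one.

The test vector is a quasimode (`exists_quasimode`): interpolate a unit plane wave f of phase θ at
both end points by the polynomial whose derivative is the L² projection of f' onto degree < p. With
E = ‖f' − A'‖² and R = ‖f − A‖² ≤ 4E, summed over real and imaginary parts, Pythagoras gives ‖A'‖² =
θ² − E, and a duality argument gives θ²‖A‖² = θ² − 2E + θ²R. Up to higher order, E is the squared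
distance of θ^(p+1)xᵖ/p! from degree < p, so the norm of the monic Legendre polynomial yields E ≈
cθ^(2p+2) with c = `dispersionConst p`. The p-th derivative has squared modulus about θ^(2p), so the
penalty contributes about γθ^(2p+2). Altogether the form at the quasimode is θ² − t² + (c +
γ)θ^(2p+2) + O(t^(2p+4)), which changes sign at θ ≈ t − ½(c + γ)t^(2p+1); moving θ by ±M t^(2p+3)
with M large decides the sign.

A negative value needs only the quasimode. For definiteness (`elementForm_pos`), every Bloch
function is a complex multiple of the quasimode plus a bubble vanishing at both ends. The form is
coercive on bubbles for small t, and the quasimode nearly solves the equation: its squared residual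
against bubbles is O(t^(2p+4)), so the cross terms cost no more than the error already present.
`exists_sign_bounds` combines these estimates. -/

open scoped Polynomial

noncomputable section

namespace CIPFEM

/-! ### Singular members of a family of Hermitian matrices -/

open scoped ComplexOrder Matrix in
/-- A continuous family of Hermitian matrices that is positive definite at `a` and takes a negative
value at `b` becomes singular in between. -/
theorem exists_det_eq_zero_of_posDef_of_neg {n : Type*} [Fintype n] [DecidableEq n]
    {D : ℝ → Matrix n n ℂ} (hc : Continuous D) (hD : ∀ θ, (D θ).IsHermitian) {a b : ℝ}
    (ha : ∀ x : n → ℂ, x ≠ 0 → 0 < (star x ⬝ᵥ (D a *ᵥ x)).re)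
    (hb : ∃ x : n → ℂ, (star x ⬝ᵥ (D b *ᵥ x)).re < 0) :
    ∃ θ ∈ Set.uIcc a b, (D θ).det = 0 := by
  obtain ⟨x₀, hx₀⟩ := hb
  have hx₀' : x₀ ≠ 0 := by rintro rfl; simp at hx₀
  set F : ℝ → (n → ℂ) → ℝ := fun θ x => (star x ⬝ᵥ (D θ *ᵥ x)).re with hF
  have hFc : Continuous (Function.uncurry F) := by
    refine Complex.continuous_re.comp ?_
    exact Continuous.dotProduct (continuous_star.comp continuous_snd)
      (Continuous.matrix_mulVec (hc.comp continuous_fst) continuous_snd)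
  have hsc : ∀ θ x, ∀ r : ℝ, F θ ((r : ℂ) • x) = r ^ 2 * F θ x := by
    intro θ x r
    simp only [hF, Matrix.mulVec_smul, star_smul, smul_dotProduct, dotProduct_smul, smul_eq_mul,
      ← mul_assoc]
    rw [show (r : ℂ) * star (r : ℂ) = ((r ^ 2 : ℝ) : ℂ) by simp [sq], Complex.re_ofReal_mul]
  set S : Set (n → ℂ) := Metric.sphere 0 1 with hS
  have hSc : IsCompact S := isCompact_sphere 0 1
  have hSn : ∀ x : n → ℂ, x ≠ 0 → (((‖x‖⁻¹ : ℝ) : ℂ) • x) ∈ S := by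
    intro x hx
    have : ‖x‖ ≠ 0 := norm_ne_zero_iff.2 hx
    simp only [hS, mem_sphere_iff_norm, sub_zero, norm_smul, Complex.norm_real, norm_inv, norm_norm]
    exact inv_mul_cancel₀ this
  -- The sphere is that of the sup norm, so `f` is not the least eigenvalue. By homogeneity it still
  -- has the same sign, and compactness of the sphere makes it continuous.
  set f : ℝ → ℝ := fun θ => sInf (F θ '' S) with hf
  have hfc : Continuous f := hSc.continuous_sInf hFc
  have hatt : ∀ θ, ∃ x ∈ S, f θ = F θ x ∧ ∀ y ∈ S, F θ x ≤ F θ y := fun θ =>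
    hSc.exists_sInf_image_eq_and_le ⟨_, hSn x₀ hx₀'⟩
      (by fun_prop : Continuous (F θ)).continuousOn
  have hfa : 0 < f a := by
    obtain ⟨x, hx, he, -⟩ := hatt a
    rw [he]
    refine ha x ?_
    rintro rfl
    simp [hS] at hx
  have hfb : f b < 0 := by
    obtain ⟨x, hx, he, hle⟩ := hatt b
    rw [he]
    refine (hle _ (hSn x₀ hx₀')).trans_lt ?_
    rw [hsc]
    have : 0 < ‖x₀‖⁻¹ := inv_pos.2 (norm_pos_iff.2 hx₀')
    exact mul_neg_of_pos_of_neg (by positivity) hx₀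
  obtain ⟨θ, hθ, hz⟩ : (0 : ℝ) ∈ f '' Set.uIcc a b :=
    intermediate_value_uIcc hfc.continuousOn (Set.mem_uIcc.2 (Or.inr ⟨hfb.le, hfa.le⟩))
  refine ⟨θ, hθ, ?_⟩
  obtain ⟨x, hx, he, hle⟩ := hatt θ
  have hx0 : x ≠ 0 := by rintro rfl; simp [hS] at hx
  have him : ∀ y : n → ℂ, (star y ⬝ᵥ (D θ *ᵥ y)).im = 0 := fun y =>
    (hD θ).im_star_dotProduct_mulVec_self y
  -- At a zero of the minimum the form is nonnegative, and a null vector of a positive semidefinite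
  -- form lies in the kernel.
  have hps : (D θ).PosSemidef := by
    refine Matrix.PosSemidef.of_dotProduct_mulVec_nonneg (hD θ) fun y => ?_
    rw [Complex.nonneg_iff]
    refine ⟨?_, (him y).symm⟩
    by_cases hy : y = 0
    · simp [hy]
    · have h1 := hle _ (hSn y hy)
      rw [hsc, ← he, hz] at h1
      have : 0 < ‖y‖⁻¹ := inv_pos.2 (norm_pos_iff.2 hy)
      exact nonneg_of_mul_nonneg_right h1 (by positivity)
  have h0 : star x ⬝ᵥ (D θ *ᵥ x) = 0 :=
    Complex.ext (by rw [Complex.zero_re]; exact he.symm.trans hz) (him x)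
  exact Matrix.exists_mulVec_eq_zero_iff.1 ⟨x, hx0, (hps.dotProduct_mulVec_zero_iff x).1 h0⟩

/-! ### The reference element -/

/-- The Lagrange basis polynomials of the reference element `[0, 1]`, extended by zero to all
integer indices. -/
def refBasis (p : ℕ) (a : ℤ) : ℝ[X] := localBasis p 1 a 0

theorem refBasis_eval {p : ℕ} (hp : 1 ≤ p) (a : ℤ) {l : ℕ} (hl : l ≤ p) :
    (refBasis p a).eval ((l : ℝ) / p) = if (l : ℤ) = a then 1 else 0 := by
  have := localBasis_eval_node hp one_pos a 0 hl
  simpa [node, refBasis] using this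

theorem natDegree_refBasis_le {p : ℕ} (hp : 1 ≤ p) (a : ℤ) : (refBasis p a).natDegree ≤ p := by
  have := Lagrange.degree_interpolate_le
    (r := fun l : ℕ => if (0 : ℤ) * p + l = a then (1 : ℝ) else 0) (local_injOn hp one_pos 0)
  rw [Finset.card_range, Nat.add_sub_cancel] at this
  exact Polynomial.natDegree_le_of_degree_le this

/-- The extension by zero allows formulas for all global indices, without recording which elements
meet a given support. -/
theorem refBasis_eq_zero {p : ℕ} {a : ℤ} (ha : a < 0 ∨ (p : ℤ) < a) : refBasis p a = 0 := by
  rw [refBasis, localBasis, Lagrange.interpolate_eq_of_values_eq_on (r' := 0), map_zero]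
  intro l hl
  have := Finset.mem_range.1 hl
  simp only [Pi.zero_apply, ite_eq_right_iff]
  intro h
  omega

theorem localBasis_eq_comp {p : ℕ} (hp : 1 ≤ p) {h : ℝ} (hh : 0 < h) (m j : ℤ) :
    localBasis p h m j =
      (refBasis p (m - j * p)).comp (Polynomial.C h⁻¹ * Polynomial.X - Polynomial.C (j : ℝ)) := by
  symm
  refine Lagrange.eq_interpolate_of_eval_eq _ (local_injOn hp hh j) ?_ ?_
  · rw [Finset.card_range]
    refine lt_of_le_of_lt Polynomial.degree_le_natDegree ?_
    refine WithBot.coe_lt_coe.2 (Nat.lt_succ_of_le ?_)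
    refine Polynomial.natDegree_comp_le.trans ?_
    calc _ ≤ p * 1 := Nat.mul_le_mul (natDegree_refBasis_le hp _) (by compute_degree)
      _ = p := mul_one p
  · intro l hl
    have hl' : l ≤ p := Nat.lt_succ_iff.1 (Finset.mem_range.1 hl)
    have hp' : (p : ℝ) ≠ 0 := by positivity
    have : h⁻¹ * node p h (j * p + l) - j = (l : ℝ) / p := by
      rw [node]; push_cast; field_simp; ring
    simp only [Polynomial.eval_comp, Polynomial.eval_sub, Polynomial.eval_mul, Polynomial.eval_C,
      Polynomial.eval_X, this, refBasis_eval hp _ hl']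
    congr 1
    apply propext
    constructor <;> intro h <;> omega

theorem nodalBasis_eq_refBasis {p : ℕ} (hp : 1 ≤ p) {h : ℝ} (hh : 0 < h) (m j : ℤ) {x : ℝ}
    (hx : x ∈ element h j) :
    nodalBasis p h m x = (refBasis p (m - j * p)).eval (h⁻¹ * x - j) := by
  rw [nodalBasis_eq_on_element hp hh m j hx, localBasis_eq_comp hp hh]
  simp

theorem deriv_nodalBasis {p : ℕ} (hp : 1 ≤ p) {h : ℝ} (hh : 0 < h) (m j : ℤ) {x : ℝ}
    (hx : x ∈ Set.Ioo (j * h) ((j + 1) * h)) :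
    deriv (nodalBasis p h m) x =
      h⁻¹ * (refBasis p (m - j * p)).derivative.eval (h⁻¹ * x - j) := by
  have h1 : nodalBasis p h m =ᶠ[nhds x] fun y => (localBasis p h m j).eval y :=
    Filter.eventuallyEq_of_mem (isOpen_Ioo.mem_nhds hx) fun y hy =>
      nodalBasis_eq_on_element hp hh m j (Set.Ioo_subset_Icc_self hy)
  rw [h1.deriv_eq, Polynomial.deriv, localBasis_eq_comp hp hh, Polynomial.derivative_comp]
  simp

theorem iteratedDeriv_polynomial_eval (P : ℝ[X]) (n : ℕ) :
    iteratedDeriv n (fun x => P.eval x) = fun x => (Polynomial.derivative^[n] P).eval x := by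
  induction n with
  | zero => simp
  | succ n ih =>
    rw [iteratedDeriv_succ, ih, Function.iterate_succ_apply']
    funext x
    exact Polynomial.deriv _

theorem iterate_derivative_eval_of_natDegree_le {p : ℕ} {P : ℝ[X]} (hP : P.natDegree ≤ p)
    (x : ℝ) : (Polynomial.derivative^[p] P).eval x = p.factorial * P.coeff p := by
  have h0 : (Polynomial.derivative^[p] P).natDegree ≤ 0 := by
    refine (Polynomial.natDegree_iterate_derivative P p).trans ?_
    omega
  rw [Polynomial.eq_C_of_natDegree_le_zero h0, Polynomial.eval_C, Polynomial.coeff_iterate_derivative]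
  simp [Nat.descFactorial_self]

/-- The value of the (constant) `p`-th derivative of a polynomial of degree at most `p`. -/
def topDeriv (p : ℕ) : ℝ[X] →ₗ[ℝ] ℝ := (p.factorial : ℝ) • Polynomial.lcoeff ℝ p

theorem topDeriv_apply (p : ℕ) (P : ℝ[X]) : topDeriv p P = p.factorial * P.coeff p := rfl

theorem iteratedDerivWithin_nodalBasis {p : ℕ} (hp : 1 ≤ p) {h : ℝ} (hh : 0 < h) (m j : ℤ) {x : ℝ}
    (hx : x ∈ element h j) :
    iteratedDerivWithin p (nodalBasis p h m) (element h j) x =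
      h⁻¹ ^ p * topDeriv p (refBasis p (m - j * p)) := by
  have hlt : (j : ℝ) * h < (j + 1) * h := by nlinarith
  have hu : UniqueDiffOn ℝ (element h j) := uniqueDiffOn_Icc hlt
  set f : ℝ → ℝ := fun z => (refBasis p (m - j * p)).eval (z - (j : ℝ)) with hf
  have hfc : ContDiff ℝ p f :=
    ((refBasis p (m - j * p)).contDiff_aeval (𝕜 := ℝ) p).comp (contDiff_id.sub contDiff_const)
  have hs := iteratedDeriv_comp_sub_const p (fun y : ℝ => (refBasis p (m - j * p)).eval y) (j : ℝ)
  rw [iteratedDeriv_polynomial_eval] at hs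
  have h1 : Set.EqOn (nodalBasis p h m) (fun y => f (h⁻¹ * y)) (element h j) :=
    fun y hy => nodalBasis_eq_refBasis hp hh m j hy
  have hgc : ContDiff ℝ p fun y => f (h⁻¹ * y) := hfc.comp (contDiff_const.mul contDiff_id)
  rw [iteratedDerivWithin_congr h1 hx, iteratedDerivWithin_eq_iteratedDeriv hu hgc.contDiffAt hx,
    iteratedDeriv_comp_const_mul hfc, hf, hs]
  simp only [topDeriv_apply, iterate_derivative_eval_of_natDegree_le (natDegree_refBasis_le hp _)]

theorem jump_nodalBasis {p : ℕ} (hp : 1 ≤ p) {h : ℝ} (hh : 0 < h) (m j : ℤ) :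
    jump p h (nodalBasis p h m) j =
      h⁻¹ ^ p * (topDeriv p (refBasis p (m - (j - 1) * p)) -
        topDeriv p (refBasis p (m - j * p))) := by
  rw [jump, iteratedDerivWithin_nodalBasis hp hh m (j - 1), iteratedDerivWithin_nodalBasis hp hh m j,
    mul_sub]
  · exact ⟨le_rfl, by nlinarith⟩
  · refine ⟨?_, ?_⟩ <;> push_cast <;> nlinarith

/-- The `L²(0, 1)` inner product of polynomials. -/
def polyInner : ℝ[X] →ₗ[ℝ] ℝ[X] →ₗ[ℝ] ℝ :=
  LinearMap.mk₂ ℝ (fun P Q => ∫ x in (0 : ℝ)..1, P.eval x * Q.eval x)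
    (fun P P' Q => by
      simp only [Polynomial.eval_add, add_mul]
      exact intervalIntegral.integral_add (Continuous.intervalIntegrable (by fun_prop) _ _)
        (Continuous.intervalIntegrable (by fun_prop) _ _))
    (fun c P Q => by simp [mul_assoc])
    (fun P Q Q' => by
      simp only [Polynomial.eval_add, mul_add]
      exact intervalIntegral.integral_add (Continuous.intervalIntegrable (by fun_prop) _ _)
        (Continuous.intervalIntegrable (by fun_prop) _ _))
    (fun c P Q => by simp [mul_left_comm])

theorem polyInner_apply (P Q : ℝ[X]) :
    polyInner P Q = ∫ x in (0 : ℝ)..1, P.eval x * Q.eval x := rfl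

/-- The values are prescribed on open elements only, since derivatives of basis functions may fail
to exist at mesh points. -/
theorem integral_eq_of_piecewise {F : ℝ → ℝ} {G₀ G₁ : ℝ[X]} {h : ℝ} (hh : 0 < h)
    (h0 : ∀ x ∈ Set.Ioo (-h) 0, F x = G₀.eval (h⁻¹ * x + 1))
    (h1 : ∀ x ∈ Set.Ioo 0 h, F x = G₁.eval (h⁻¹ * x)) (hz : ∀ x, x ∉ Set.Icc (-h) h → F x = 0) :
    ∫ x, F x = h * ((∫ x in (0 : ℝ)..1, G₀.eval x) + ∫ x in (0 : ℝ)..1, G₁.eval x) := by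
  have e0 : ∀ x ∈ Set.Ioo (-h) 0, G₀.eval (h⁻¹ * x + 1) = F x := fun x hx => (h0 x hx).symm
  have e1 : ∀ x ∈ Set.Ioo 0 h, G₁.eval (h⁻¹ * x) = F x := fun x hx => (h1 x hx).symm
  have i0 : IntervalIntegrable F MeasureTheory.volume (-h) 0 := by
    refine IntervalIntegrable.congr_uIoo (f := fun x => G₀.eval (h⁻¹ * x + 1)) ?_
      ?_
    · exact Continuous.intervalIntegrable (by fun_prop) _ _
    · rw [Set.uIoo_of_le (by linarith)]; exact e0
  have i1 : IntervalIntegrable F MeasureTheory.volume 0 h := by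
    refine IntervalIntegrable.congr_uIoo (f := fun x => G₁.eval (h⁻¹ * x)) ?_
      ?_
    · exact Continuous.intervalIntegrable (by fun_prop) _ _
    · rw [Set.uIoo_of_le (by linarith)]; exact e1
  rw [← MeasureTheory.setIntegral_eq_integral_of_forall_compl_eq_zero hz,
    MeasureTheory.integral_Icc_eq_integral_Ioc, ← intervalIntegral.integral_of_le (by linarith),
    ← intervalIntegral.integral_add_adjacent_intervals i0 i1, mul_add]
  congr 1
  · rw [← intervalIntegral.integral_congr_uIoo (f := fun x => G₀.eval (h⁻¹ * x + 1))
      (by rw [Set.uIoo_of_le (by linarith)]; exact e0),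
      intervalIntegral.integral_comp_mul_add (fun y => G₀.eval y) (by positivity : h⁻¹ ≠ 0)]
    simp [hh.ne']
  · rw [← intervalIntegral.integral_congr_uIoo (f := fun x => G₁.eval (h⁻¹ * x))
      (by rw [Set.uIoo_of_le (by linarith)]; exact e1),
      intervalIntegral.integral_comp_mul_left (fun y => G₁.eval y) (by positivity : h⁻¹ ≠ 0)]
    simp [hh.ne']

theorem nodalBasis_eq_zero_of_notMem {p : ℕ} {h : ℝ} (hp : 1 ≤ p) (hh : 0 < h) {s : ℕ} (hs : s < p)
    {x : ℝ} (hx : x ∉ Set.Icc (-h) h) : nodalBasis p h (s : ℤ) x = 0 := by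
  have a1 : ((⌊x / h⌋ : ℤ) : ℝ) * h ≤ x := (le_div_iff₀ hh).1 (Int.floor_le _)
  have a2 : x < (⌊x / h⌋ + 1) * h := (div_lt_iff₀ hh).1 (Int.lt_floor_add_one _)
  rw [nodalBasis_eq_refBasis hp hh _ ⌊x / h⌋ ⟨a1, a2.le⟩]
  set j := ⌊x / h⌋
  have hj : j < -1 ∨ 0 < j := by
    by_contra! hcon
    obtain ⟨c1, c2⟩ := hcon
    have c1' : (-1 : ℝ) ≤ j := by exact_mod_cast c1
    have c2' : (j : ℝ) ≤ 0 := by exact_mod_cast c2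
    exact hx ⟨by nlinarith, by nlinarith⟩
  rw [refBasis_eq_zero]
  · simp
  · rcases hj with hj | hj
    · right; nlinarith
    · left; nlinarith

/-- For 0 ≤ s < p the support of φ_s lies in K₋₁ ∪ K₀. Seen from K₋₁ every local index is shifted by
p, which gives the first summand. -/
theorem helmholtzForm_nodalBasis {p : ℕ} (hp : 1 ≤ p) {h : ℝ} (hh : 0 < h) (k : ℝ) (m : ℤ) {s : ℕ}
    (hs : s < p) :
    helmholtzForm k (nodalBasis p h m) (nodalBasis p h (s : ℤ)) = h⁻¹ *
      ((polyInner (refBasis p (m + p)).derivative (refBasis p (s + p)).derivative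
          - (k * h) ^ 2 * polyInner (refBasis p (m + p)) (refBasis p (s + p)))
        + (polyInner (refBasis p m).derivative (refBasis p s).derivative
          - (k * h) ^ 2 * polyInner (refBasis p m) (refBasis p s))) := by
  have hd := fun (n : ℤ) (x : ℝ) (hx : x ∈ Set.Ioo (-h) 0) =>
    deriv_nodalBasis hp hh n (-1) (x := x) (by simpa using hx)
  have hd' := fun (n : ℤ) (x : ℝ) (hx : x ∈ Set.Ioo 0 h) =>
    deriv_nodalBasis hp hh n 0 (x := x) (by simpa using hx)
  have hv := fun (n : ℤ) (x : ℝ) (hx : x ∈ Set.Ioo (-h) 0) =>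
    nodalBasis_eq_refBasis hp hh n (-1) (x := x)
      (by simpa [element] using Set.Ioo_subset_Icc_self hx)
  have hv' := fun (n : ℤ) (x : ℝ) (hx : x ∈ Set.Ioo 0 h) =>
    nodalBasis_eq_refBasis hp hh n 0 (x := x)
      (by simpa [element] using Set.Ioo_subset_Icc_self hx)
  have hz := fun x (hx : x ∉ Set.Icc (-h) h) => nodalBasis_eq_zero_of_notMem hp hh hs hx
  have hz' : ∀ x, x ∉ Set.Icc (-h) h → deriv (nodalBasis p h (s : ℤ)) x = 0 := by
    intro x hx
    have : nodalBasis p h (s : ℤ) =ᶠ[nhds x] fun _ => 0 :=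
      Filter.eventuallyEq_of_mem (isClosed_Icc.isOpen_compl.mem_nhds hx) fun y hy => hz y hy
    rw [this.deriv_eq]; simp
  rw [helmholtzForm,
    integral_eq_of_piecewise hh
      (G₀ := Polynomial.C (h⁻¹ ^ 2) * ((refBasis p (m + p)).derivative *
        (refBasis p (s + p)).derivative))
      (G₁ := Polynomial.C (h⁻¹ ^ 2) * ((refBasis p m).derivative * (refBasis p s).derivative)),
    integral_eq_of_piecewise hh (G₀ := refBasis p (m + p) * refBasis p (s + p))
      (G₁ := refBasis p m * refBasis p s)]
  · simp only [polyInner_apply, Polynomial.eval_mul, Polynomial.eval_C,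
      intervalIntegral.integral_const_mul]
    field_simp
    ring
  · intro x hx; simp [hv _ x hx]
  · intro x hx; simp [hv' _ x hx]
  · intro x hx; simp [hz x hx]
  · intro x hx; simp [hd _ x hx]; ring
  · intro x hx; simp [hd' _ x hx]; ring
  · intro x hx; simp [hz' x hx]

/-- Only the mesh points −h, 0, h see a jump of φ_s. The weight h^(2p−1) against two p-th
derivatives leaves h⁻¹, the scaling of the stiffness term. -/
theorem penalty_nodalBasis {p : ℕ} (hp : 1 ≤ p) {h : ℝ} (hh : 0 < h) (γ : ℝ) (m : ℤ) {s : ℕ}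
    (hs : s < p) :
    penalty p h γ (nodalBasis p h m) (nodalBasis p h (s : ℤ)) = h⁻¹ * (γ *
      (-(topDeriv p (refBasis p (m + 2 * p)) - topDeriv p (refBasis p (m + p))) *
          topDeriv p (refBasis p (s + p))
        + (topDeriv p (refBasis p (m + p)) - topDeriv p (refBasis p m)) *
          (topDeriv p (refBasis p (s + p)) - topDeriv p (refBasis p s))
        + (topDeriv p (refBasis p m) - topDeriv p (refBasis p (m - p))) *
          topDeriv p (refBasis p s))) := by
  have hhp : h ^ (2 * p - 1) * (h⁻¹ ^ p * h⁻¹ ^ p) = h⁻¹ := by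
    obtain ⟨r, rfl⟩ : ∃ r, p = r + 1 := ⟨p - 1, by omega⟩
    rw [show 2 * (r + 1) - 1 = r + (r + 1) by omega, pow_add, inv_pow]
    field_simp
    ring
  have z1 : refBasis p (s + 2 * p) = 0 := refBasis_eq_zero (by right; omega)
  have z2 : refBasis p (s - p) = 0 := refBasis_eq_zero (by left; omega)
  rw [penalty, finsum_eq_sum_of_support_subset (s := {-1, 0, 1})]
  · rw [Finset.sum_insert (by decide), Finset.sum_insert (by decide), Finset.sum_singleton]
    simp only [jump_nodalBasis hp hh]
    rw [show ∀ y : ℝ, h⁻¹ * y = h ^ (2 * p - 1) * (h⁻¹ ^ p * h⁻¹ ^ p) * y by rw [hhp]; simp]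
    simp only [Int.reduceNeg, Int.reduceSub, neg_mul, sub_neg_eq_add, zero_mul, one_mul, sub_zero,
      sub_self, z1, z2, map_zero]
    ring
  · intro j hj
    by_contra hcon
    apply hj
    have hj' : j < -1 ∨ 1 < j := by
      simp only [Int.reduceNeg, Finset.coe_insert, Finset.coe_singleton, Set.mem_insert_iff,
        Set.mem_singleton_iff, not_or] at hcon
      omega
    have y1 : refBasis p (s - (j - 1) * p) = 0 := refBasis_eq_zero (by
      rcases hj' with hj | hj
      · right; nlinarith
      · left; nlinarith)
    have y2 : refBasis p (s - j * p) = 0 := refBasis_eq_zero (by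
      rcases hj' with hj | hj
      · right; nlinarith
      · left; nlinarith)
    simp [jump_nodalBasis hp hh, y1, y2]

/-! ### Factorisation of the Bloch matrix through one element -/

theorem polyInner_comm (P Q : ℝ[X]) : polyInner P Q = polyInner Q P := by
  simp only [polyInner_apply, mul_comm]

/-- The CIP-FEM form on the reference element, with penalty weight `g`. -/
def elementForm (p : ℕ) (t g : ℝ) : ℝ[X] →ₗ[ℝ] ℝ[X] →ₗ[ℝ] ℝ :=
  LinearMap.mk₂ ℝ (fun P Q => polyInner P.derivative Q.derivative - t ^ 2 * polyInner P Q +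
      g * (topDeriv p P * topDeriv p Q))
    (fun P P' Q => by simp only [map_add, LinearMap.add_apply]; ring)
    (fun c P Q => by
      simp only [map_smul, LinearMap.smul_apply, smul_eq_mul]; ring)
    (fun P Q Q' => by simp only [map_add]; ring)
    (fun c P Q => by
      simp only [map_smul, smul_eq_mul]; ring)

theorem elementForm_apply (p : ℕ) (t g : ℝ) (P Q : ℝ[X]) :
    elementForm p t g P Q = polyInner P.derivative Q.derivative - t ^ 2 * polyInner P Q +
      g * (topDeriv p P * topDeriv p Q) := rfl

theorem elementForm_comm (p : ℕ) (t g : ℝ) (P Q : ℝ[X]) :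
    elementForm p t g P Q = elementForm p t g Q P := by
  rw [elementForm_apply, elementForm_apply, polyInner_comm, polyInner_comm P, mul_comm (topDeriv p P)]

/-- The Gram matrix of the element form in the nodal basis of the reference element. -/
def elementMatrix (p : ℕ) (t g : ℝ) : Matrix (Fin (p + 1)) (Fin (p + 1)) ℂ :=
  Matrix.of fun a b =>
    ((elementForm p t g (refBasis p (a : ℕ)) (refBasis p (b : ℕ)) : ℝ) : ℂ)

/-- The matrix that extends the nodal values at the first `p` nodes of an element to all of its
nodes by the Bloch condition. -/
def blochExtension (p : ℕ) (z : ℂ) : Matrix (Fin (p + 1)) (Fin p) ℂ :=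
  Matrix.of fun a q => (if (a : ℕ) = q then 1 else 0) + if (a : ℕ) = q + p then z else 0

/-- The index q + p lies in the element only for q = 0. Requiring F to vanish beyond p makes the
right side uniform in q. -/
theorem sum_blochExtension_mul {p : ℕ} (z : ℂ) (F : ℕ → ℂ) (hF : ∀ n, p < n → F n = 0)
    (q : Fin p) :
    ∑ a : Fin (p + 1), blochExtension p z a q * F a = F q + z * F (q + p) := by
  have h1 : ∀ a : Fin (p + 1), blochExtension p z a q * F a =
      (fun n : ℕ => (if n = q then F n else 0) + if n = q + p then z * F n else 0) a := by
    intro a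
    simp only [blochExtension, Matrix.of_apply, add_mul, ite_mul, one_mul, zero_mul]
  rw [Finset.sum_congr rfl fun a _ => h1 a, Fin.sum_univ_eq_sum_range
    (fun n : ℕ => (if n = q then F n else 0) + if n = q + p then z * F n else 0),
    Finset.sum_add_distrib, Finset.sum_ite_eq', Finset.sum_ite_eq',
    if_pos (Finset.mem_range.2 (by omega))]
  congr 1
  split_ifs with h
  · rfl
  · rw [hF _ (by have := mt Finset.mem_range.2 h; omega), mul_zero]

theorem cipForm_nodalBasis {p : ℕ} (hp : 1 ≤ p) {h : ℝ} (hh : 0 < h) (k γ : ℝ) (m : ℤ) {s : ℕ}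
    (hs : s < p) :
    cipForm p h k γ (nodalBasis p h m) (nodalBasis p h (s : ℤ)) = h⁻¹ *
      (elementForm p (k * h) 0 (refBasis p (m + p)) (refBasis p (s + p))
        + elementForm p (k * h) 0 (refBasis p m) (refBasis p s)
        + γ * (-(topDeriv p (refBasis p (m + 2 * p)) - topDeriv p (refBasis p (m + p))) *
            topDeriv p (refBasis p (s + p))
          + (topDeriv p (refBasis p (m + p)) - topDeriv p (refBasis p m)) *
            (topDeriv p (refBasis p (s + p)) - topDeriv p (refBasis p s))
          + (topDeriv p (refBasis p m) - topDeriv p (refBasis p (m - p))) *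
            topDeriv p (refBasis p s))) := by
  rw [cipForm, helmholtzForm_nodalBasis hp hh k m hs, penalty_nodalBasis hp hh γ m hs]
  simp only [elementForm_apply]
  ring

theorem elementForm_eq_zero_add (p : ℕ) (t g : ℝ) (P Q : ℝ[X]) :
    elementForm p t g P Q = elementForm p t 0 P Q + g * (topDeriv p P * topDeriv p Q) := by
  simp only [elementForm_apply]; ring

-- The p-th derivative of a Bloch function is constant on each element and is multiplied by z =
-- exp(iθ) from one element to the next. Each jump is therefore a unimodular multiple of (1 − z)
-- times one constant, and the penalty per period carries the factor |1 − z|² = 2 − z − z⁻¹ = 2 −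
-- 2cos θ.
open scoped Matrix in
theorem blochMatrix_eq {p : ℕ} (hp : 1 ≤ p) {h : ℝ} (hh : 0 < h) (k γ kh : ℝ) :
    blochMatrix p h k γ kh = ((h⁻¹ : ℝ) : ℂ) •
      ((blochExtension p (Complex.exp (Complex.I * (kh * h : ℝ))))ᴴ *
        elementMatrix p (k * h) (γ * (2 - 2 * Real.cos (kh * h))) *
        blochExtension p (Complex.exp (Complex.I * (kh * h : ℝ)))) := by
  set θ : ℝ := kh * h with hθ
  set z : ℂ := Complex.exp (Complex.I * θ) with hz
  have hzp : ∀ m : ℤ, Complex.exp (Complex.I * m * kh * h) = z ^ m := by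
    intro m
    rw [hz, ← Complex.exp_int_mul, hθ]
    congr 1
    push_cast
    ring
  have hzi : star z = z⁻¹ := by
    rw [hz, ← Complex.exp_neg, Complex.star_def, ← Complex.exp_conj]
    simp
  have hz0 : z ≠ 0 := Complex.exp_ne_zero _
  have hcos : ((2 - 2 * Real.cos θ : ℝ) : ℂ) = 2 - z - z⁻¹ := by
    rw [hz, ← Complex.exp_neg]
    push_cast
    rw [Complex.cos]
    ring_nf
  ext s q
  have hs := s.2
  have hq := q.2
  have hzero : ∀ i : ℤ, i < 0 ∨ 1 < i → refBasis p ((q : ℕ) + i * p) = 0 := by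
    intro i hi
    apply refBasis_eq_zero
    rcases hi with hi | hi
    · left; nlinarith
    · right; nlinarith
  have hform := fun m : ℤ => cipForm_nodalBasis hp hh k γ (((q : ℕ) : ℤ) + m * p) hs
  have e1 : ∀ m : ℤ, ((q : ℕ) : ℤ) + m * p + p = (q : ℕ) + (m + 1) * p := fun m => by ring
  have e2 : ∀ m : ℤ, ((q : ℕ) : ℤ) + m * p + 2 * p = (q : ℕ) + (m + 2) * p := fun m => by ring
  have e3 : ∀ m : ℤ, ((q : ℕ) : ℤ) + m * p - p = (q : ℕ) + (m - 1) * p := fun m => by ring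
  simp only [e1, e2, e3] at hform
  have hsum1 : ∀ F : ℤ → ℂ, (∀ n : ℤ, (p : ℤ) < n → F n = 0) →
      ∑ a : Fin (p + 1), F (a : ℕ) * blochExtension p z a q = F (q : ℕ) + z * F ((q : ℕ) + p) := by
    intro F hF
    rw [← Nat.cast_add, ← sum_blochExtension_mul z (fun n => F (n : ℕ)) (fun n hn => hF _ (by omega)) q]
    exact Finset.sum_congr rfl fun a _ => mul_comm _ _
  have hsum2 : ∀ F : ℤ → ℂ, (∀ n : ℤ, (p : ℤ) < n → F n = 0) →
      ∑ a : Fin (p + 1), star (blochExtension p z a s) * F (a : ℕ) =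
        F (s : ℕ) + z⁻¹ * F ((s : ℕ) + p) := by
    intro F hF
    rw [← Nat.cast_add, ← sum_blochExtension_mul z⁻¹ (fun n => F (n : ℕ)) (fun n hn => hF _ (by omega)) s]
    refine Finset.sum_congr rfl fun a _ => ?_
    congr 1
    simp only [blochExtension, Matrix.of_apply, star_add, apply_ite star, star_one, star_zero, hzi]
  rw [Matrix.smul_apply, Matrix.mul_apply]
  simp only [Matrix.mul_apply, Matrix.conjTranspose_apply, elementMatrix, Matrix.of_apply, smul_eq_mul]
  set g : ℝ := γ * (2 - 2 * Real.cos θ) with hg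
  have hG : ∀ b : ℤ, ∑ a : Fin (p + 1), star (blochExtension p z a s) *
      ((elementForm p (k * h) g (refBasis p (a : ℕ)) (refBasis p b) : ℝ) : ℂ) =
      ((elementForm p (k * h) g (refBasis p (s : ℕ)) (refBasis p b) : ℝ) : ℂ) +
      z⁻¹ * ((elementForm p (k * h) g (refBasis p ((s : ℕ) + p)) (refBasis p b) : ℝ) : ℂ) := by
    intro b
    refine hsum2 (fun n => ((elementForm p (k * h) g (refBasis p n) (refBasis p b) : ℝ) : ℂ)) ?_
    intro n hn
    simp [refBasis_eq_zero (Or.inr hn)]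
  simp only [hG]
  rw [hsum1 (fun b => ((elementForm p (k * h) g (refBasis p (s : ℕ)) (refBasis p b) : ℝ) : ℂ) +
      z⁻¹ * ((elementForm p (k * h) g (refBasis p ((s : ℕ) + p)) (refBasis p b) : ℝ) : ℂ))
    (fun n hn => by simp [refBasis_eq_zero (Or.inr hn)])]
  simp only [blochMatrix, Matrix.of_apply, hzp]
  -- The form involves the local indices q + (m + i)p with −1 ≤ i ≤ 2, which can be nonzero only for
  -- m + i ∈ {0, 1}.
  rw [finsum_eq_sum_of_support_subset (s := {-2, -1, 0, 1, 2})]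
  · rw [Finset.sum_insert (by decide), Finset.sum_insert (by decide), Finset.sum_insert (by decide),
      Finset.sum_insert (by decide), Finset.sum_singleton]
    simp only [hform]
    have q0 : refBasis p ((q : ℕ) + 0 * p) = refBasis p (q : ℕ) := by simp
    have q1 : refBasis p ((q : ℕ) + 1 * p) = refBasis p ((q : ℕ) + p) := by simp
    have n1 := hzero (-1) (by simp)
    have n2 := hzero (-2) (by simp)
    have n3 := hzero (-3) (by simp)
    have n4 := hzero 2 (by simp)
    have n5 := hzero 3 (by simp)
    have n6 := hzero 4 (by simp)
    norm_num only at n1 n2 n3 n4 n5 n6 q0 q1 ⊢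
    simp only [elementForm_eq_zero_add p (k * h) g]
    simp only [hg, n1, n2, n3, n4, n5, n6, q0, q1, map_zero,
      LinearMap.zero_apply, elementForm_comm p (k * h) 0 (refBasis p (s : ℕ)),
      elementForm_comm p (k * h) 0 (refBasis p ((s : ℕ) + p))]
    push_cast
    have hcos' : 2 - 2 * Complex.cos θ = 2 - z - z⁻¹ := by rw [← hcos]; push_cast; rfl
    rw [hcos']
    simp only [zpow_neg, zpow_ofNat]
    field_simp
    ring
  · intro m hm
    by_contra hcon
    apply hm
    have hm' : m < -2 ∨ 2 < m := by
      simp only [Int.reduceNeg, Finset.coe_insert, Finset.coe_singleton, Set.mem_insert_iff,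
        Set.mem_singleton_iff, not_or] at hcon
      omega
    simp [hform, hzero m (by omega), hzero (m + 1) (by omega), hzero (m + 2) (by omega),
      hzero (m - 1) (by omega)]

/-! ### The Bloch form on pairs of real polynomials -/

/-- The pair `(A, B)` of real and imaginary parts of a complex polynomial satisfies the Bloch
condition with phase `θ` on the reference element. -/
def BlochPair (θ : ℝ) (A B : ℝ[X]) : Prop :=
  A.eval 1 = Real.cos θ * A.eval 0 - Real.sin θ * B.eval 0 ∧
    B.eval 1 = Real.sin θ * A.eval 0 + Real.cos θ * B.eval 0

theorem refNodes_injOn {p : ℕ} (hp : 1 ≤ p) :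
    Set.InjOn (fun l : ℕ => (l : ℝ) / p) (Finset.range (p + 1) : Set ℕ) := by
  intro a _ b _ hab
  have hp' : (p : ℝ) ≠ 0 := by positivity
  have := (div_left_inj' hp').1 hab
  exact_mod_cast this

theorem eq_sum_refBasis {p : ℕ} (hp : 1 ≤ p) {A : ℝ[X]} (hA : A.natDegree ≤ p) :
    A = ∑ a : Fin (p + 1), A.eval ((a : ℕ) / p : ℝ) • refBasis p ((a : ℕ) : ℤ) := by
  rw [Fin.sum_univ_eq_sum_range (fun a : ℕ => A.eval ((a : ℝ) / p) • refBasis p (a : ℤ))]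
  have hdeg : ∀ P : ℝ[X], P.natDegree ≤ p → P.degree < (Finset.range (p + 1)).card := by
    intro P hP
    rw [Finset.card_range]
    exact lt_of_le_of_lt Polynomial.degree_le_natDegree (WithBot.coe_lt_coe.2 (Nat.lt_succ_of_le hP))
  refine Polynomial.eq_of_degrees_lt_of_eval_index_eq (v := fun l : ℕ => (l : ℝ) / p) _
    (refNodes_injOn hp) (hdeg A hA) (hdeg _ ?_) ?_
  · refine Polynomial.natDegree_sum_le_of_forall_le _ _ fun a _ => ?_
    exact (Polynomial.natDegree_smul_le _ _).trans (natDegree_refBasis_le hp _)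
  · intro l hl
    rw [Polynomial.eval_finsetSum]
    simp only [Polynomial.eval_smul, refBasis_eval hp _ (Nat.lt_succ_iff.1 (Finset.mem_range.1 hl)),
      Nat.cast_inj, smul_eq_mul, mul_ite, mul_one, mul_zero, Finset.sum_ite_eq, hl, if_true]

theorem exists_blochPair {p : ℕ} (hp : 1 ≤ p) (θ : ℝ) (x : Fin p → ℂ) :
    ∃ A B : ℝ[X], A.natDegree ≤ p ∧ B.natDegree ≤ p ∧ BlochPair θ A B ∧
      ∀ q : Fin p, x q = A.eval ((q : ℕ) / p : ℝ) + Complex.I * B.eval ((q : ℕ) / p : ℝ) := by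
  have hp' : (p : ℝ) ≠ 0 := by positivity
  have key : ∀ f : ℕ → ℝ, ∃ A : ℝ[X], A.natDegree ≤ p ∧ ∀ l ≤ p, A.eval ((l : ℝ) / p) = f l := by
    intro f
    refine ⟨Lagrange.interpolate (Finset.range (p + 1)) (fun l : ℕ => (l : ℝ) / p) f, ?_, ?_⟩
    · have := Lagrange.degree_interpolate_le (r := f) (refNodes_injOn hp)
      rw [Finset.card_range, Nat.add_sub_cancel] at this
      exact Polynomial.natDegree_le_of_degree_le this
    · intro l hl
      exact Lagrange.eval_interpolate_at_node (v := fun l : ℕ => (l : ℝ) / p) f (refNodes_injOn hp)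
        (Finset.mem_range.2 (Nat.lt_succ_of_le hl))
  set x₀ : ℂ := x ⟨0, hp⟩ with hx0
  -- The nodes l < p take the given values; the value at the last node l = p is forced by the Bloch
  -- condition.
  obtain ⟨A, hA, hA'⟩ := key fun l => if hl : l < p then (x ⟨l, hl⟩).re else
    Real.cos θ * x₀.re - Real.sin θ * x₀.im
  obtain ⟨B, hB, hB'⟩ := key fun l => if hl : l < p then (x ⟨l, hl⟩).im else
    Real.sin θ * x₀.re + Real.cos θ * x₀.im
  have a0 := hA' 0 (Nat.zero_le p)
  have b0 := hB' 0 (Nat.zero_le p)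
  have a1 := hA' p le_rfl
  have b1 := hB' p le_rfl
  rw [dif_pos (by omega), Nat.cast_zero, zero_div] at a0 b0
  rw [dif_neg (lt_irrefl p), div_self hp'] at a1 b1
  refine ⟨A, B, hA, hB, ⟨by rw [a1, a0, b0], by rw [b1, a0, b0]⟩, fun q => ?_⟩
  have aq := hA' q q.2.le
  have bq := hB' q q.2.le
  rw [dif_pos q.2] at aq bq
  rw [aq, bq, mul_comm]
  exact (Complex.re_add_im _).symm

-- The Gram matrix is real, so the products of A-values with B-values contribute only to the
-- imaginary part.
open scoped Matrix in
theorem re_quadForm_elementMatrix {p : ℕ} (hp : 1 ≤ p) (t g : ℝ) {A B : ℝ[X]}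
    (hA : A.natDegree ≤ p) (hB : B.natDegree ≤ p) (y : Fin (p + 1) → ℂ)
    (hy : ∀ a, y a = A.eval ((a : ℕ) / p : ℝ) + Complex.I * B.eval ((a : ℕ) / p : ℝ)) :
    (star y ⬝ᵥ (elementMatrix p t g *ᵥ y)).re = elementForm p t g A A + elementForm p t g B B := by
  have expand : ∀ P : ℝ[X], P.natDegree ≤ p → elementForm p t g P P =
      ∑ a : Fin (p + 1), ∑ b : Fin (p + 1), P.eval ((a : ℕ) / p : ℝ) * (P.eval ((b : ℕ) / p : ℝ) *
        elementForm p t g (refBasis p (a : ℕ)) (refBasis p (b : ℕ))) := by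
    intro P hP
    conv_lhs => rw [eq_sum_refBasis hp hP]
    simp only [map_sum, LinearMap.sum_apply, map_smul, LinearMap.smul_apply, smul_eq_mul, Finset.mul_sum]
    rw [Finset.sum_comm]
    refine Finset.sum_congr rfl fun a _ => Finset.sum_congr rfl fun b _ => by ring
  rw [expand A hA, expand B hB, ← Finset.sum_add_distrib]
  simp only [dotProduct, Matrix.mulVec, Finset.mul_sum, Complex.re_sum, ← Finset.sum_add_distrib]
  refine Finset.sum_congr rfl fun a _ => Finset.sum_congr rfl fun b _ => ?_
  simp only [Pi.star_apply, hy, elementMatrix, Matrix.of_apply]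
  simp
  ring

theorem blochExtension_mulVec {p : ℕ} (hp : 1 ≤ p) {θ : ℝ} {A B : ℝ[X]} (hAB : BlochPair θ A B)
    {x : Fin p → ℂ}
    (hx : ∀ q : Fin p, x q = A.eval ((q : ℕ) / p : ℝ) + Complex.I * B.eval ((q : ℕ) / p : ℝ))
    (a : Fin (p + 1)) :
    (blochExtension p (Complex.exp (Complex.I * θ))).mulVec x a =
      A.eval ((a : ℕ) / p : ℝ) + Complex.I * B.eval ((a : ℕ) / p : ℝ) := by
  have hp' : (p : ℝ) ≠ 0 := by positivity
  have hz : Complex.exp (Complex.I * θ) = Real.cos θ + Complex.I * Real.sin θ := by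
    rw [mul_comm, Complex.exp_mul_I]; push_cast; ring
  simp only [Matrix.mulVec, dotProduct, blochExtension, Matrix.of_apply, add_mul, ite_mul, one_mul,
    zero_mul, Finset.sum_add_distrib]
  rcases (Nat.lt_succ_iff.1 a.2).lt_or_eq with ha | ha
  · rw [Finset.sum_eq_single ⟨a, ha⟩, Finset.sum_eq_zero, if_pos rfl, add_zero, hx]
    · intro q _; rw [if_neg (by omega)]
    · intro q _ hq; rw [if_neg]; intro h; exact hq (Fin.ext h.symm)
    · simp
  · rw [Finset.sum_eq_zero, Finset.sum_eq_single ⟨0, hp⟩, if_pos (by simp [ha]), zero_add, hx, ha, hz,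
      div_self hp', hAB.1, hAB.2]
    · push_cast
      rw [zero_div]
      ring_nf
      simp only [Complex.I_sq]
      ring
    · intro q _ hq; rw [if_neg]; intro h; apply hq; ext; simp; omega
    · simp
    · intro q _; have := q.2; rw [if_neg (by omega)]

open scoped Matrix in
theorem re_quadForm_blochMatrix {p : ℕ} (hp : 1 ≤ p) {h : ℝ} (hh : 0 < h) (k γ : ℝ) {kh : ℝ}
    {A B : ℝ[X]} (hA : A.natDegree ≤ p) (hB : B.natDegree ≤ p) (hAB : BlochPair (kh * h) A B)
    {x : Fin p → ℂ}
    (hx : ∀ q : Fin p, x q = A.eval ((q : ℕ) / p : ℝ) + Complex.I * B.eval ((q : ℕ) / p : ℝ)) :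
    (star x ⬝ᵥ (blochMatrix p h k γ kh *ᵥ x)).re = h⁻¹ *
      (elementForm p (k * h) (γ * (2 - 2 * Real.cos (kh * h))) A A +
        elementForm p (k * h) (γ * (2 - 2 * Real.cos (kh * h))) B B) := by
  rw [blochMatrix_eq hp hh, Matrix.smul_mulVec, dotProduct_smul, smul_eq_mul,
    Complex.re_ofReal_mul, ← re_quadForm_elementMatrix hp _ _ hA hB _ (blochExtension_mulVec hp hAB hx),
    Matrix.star_mulVec, ← Matrix.dotProduct_mulVec, Matrix.mulVec_mulVec, Matrix.mulVec_mulVec,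
    Matrix.mul_assoc]

theorem isHermitian_blochMatrix {p : ℕ} (hp : 1 ≤ p) {h : ℝ} (hh : 0 < h) (k γ kh : ℝ) :
    (blochMatrix p h k γ kh).IsHermitian := by
  rw [blochMatrix_eq hp hh]
  refine Matrix.IsHermitian.smul (Matrix.isHermitian_conjTranspose_mul_mul _ ?_) ?_
  · ext a b
    simp [elementMatrix, elementForm_comm p _ _ (refBasis p (a : ℕ))]
  · exact Complex.conj_ofReal _

theorem continuous_blochMatrix {p : ℕ} (hp : 1 ≤ p) {h : ℝ} (hh : 0 < h) (k γ : ℝ) :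
    Continuous (blochMatrix p h k γ) := by
  have hE : Continuous fun kh : ℝ =>
      blochExtension p (Complex.exp (Complex.I * (kh * h : ℝ))) := by
    refine continuous_matrix fun a q => ?_
    simp only [blochExtension, Matrix.of_apply]
    split_ifs <;> fun_prop
  have hG : Continuous fun kh : ℝ =>
      elementMatrix p (k * h) (γ * (2 - 2 * Real.cos (kh * h))) := by
    refine continuous_matrix fun a b => ?_
    simp only [elementMatrix, Matrix.of_apply, elementForm_apply]
    fun_prop
  simp only [funext fun kh => blochMatrix_eq hp hh k γ kh]
  have hc := (hE.matrix_conjTranspose.matrix_mul hG).matrix_mul hE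
  exact hc.const_smul ((h⁻¹ : ℝ) : ℂ)

/-- A discrete wave number lies between a phase at which the Bloch form is positive definite and a
phase at which it takes a negative value. -/
theorem exists_discreteWaveNumber {p : ℕ} (hp : 1 ≤ p) {h : ℝ} (hh : 0 < h) (k γ : ℝ) {a b : ℝ}
    (ha : ∀ A B : ℝ[X], A.natDegree ≤ p → B.natDegree ≤ p → BlochPair a A B → (A ≠ 0 ∨ B ≠ 0) →
      0 < elementForm p (k * h) (γ * (2 - 2 * Real.cos a)) A A +
        elementForm p (k * h) (γ * (2 - 2 * Real.cos a)) B B)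
    (hb : ∃ A B : ℝ[X], A.natDegree ≤ p ∧ B.natDegree ≤ p ∧ BlochPair b A B ∧
      elementForm p (k * h) (γ * (2 - 2 * Real.cos b)) A A +
        elementForm p (k * h) (γ * (2 - 2 * Real.cos b)) B B < 0) :
    ∃ θ ∈ Set.uIcc a b, IsDiscreteWaveNumber p h k γ (θ / h) := by
  have hdiv : ∀ θ : ℝ, θ / h * h = θ := fun θ => div_mul_cancel₀ θ hh.ne'
  refine exists_det_eq_zero_of_posDef_of_neg (D := fun θ => blochMatrix p h k γ (θ / h))
    ((continuous_blochMatrix hp hh k γ).comp (continuous_id.div_const h))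
    (fun θ => isHermitian_blochMatrix hp hh k γ _) ?_ ?_
  · intro x hx
    obtain ⟨A, B, hA, hB, hAB, hxAB⟩ := exists_blochPair hp a x
    rw [re_quadForm_blochMatrix hp hh k γ hA hB (by rwa [hdiv]) hxAB, hdiv]
    refine mul_pos (inv_pos.2 hh) (ha A B hA hB hAB ?_)
    by_contra! hcon
    apply hx
    ext q
    simp [hxAB q, hcon.1, hcon.2]
  · obtain ⟨A, B, hA, hB, hAB, hneg⟩ := hb
    refine ⟨fun q => A.eval ((q : ℕ) / p : ℝ) + Complex.I * B.eval ((q : ℕ) / p : ℝ), ?_⟩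
    rw [re_quadForm_blochMatrix hp hh k γ hA hB (by rwa [hdiv]) fun q => rfl, hdiv]
    exact mul_neg_of_pos_of_neg (inv_pos.2 hh) hneg

/-! ### The inner product of `L²(0, 1)` -/

/-- The `L²(0, 1)` inner product of functions. -/
def l2 (f g : ℝ → ℝ) : ℝ := ∫ x in (0 : ℝ)..1, f x * g x

theorem polyInner_eq_l2 (P Q : ℝ[X]) :
    polyInner P Q = l2 (fun x => P.eval x) (fun x => Q.eval x) := rfl

theorem l2_comm (f g : ℝ → ℝ) : l2 f g = l2 g f := by
  simp only [l2, mul_comm]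

theorem l2_add_left {f₁ f₂ g : ℝ → ℝ} (h₁ : Continuous f₁) (h₂ : Continuous f₂) (hg : Continuous g) :
    l2 (fun x => f₁ x + f₂ x) g = l2 f₁ g + l2 f₂ g := by
  simp only [l2, add_mul]
  exact intervalIntegral.integral_add (Continuous.intervalIntegrable (by fun_prop) _ _)
    (Continuous.intervalIntegrable (by fun_prop) _ _)

theorem l2_sub_left {f₁ f₂ g : ℝ → ℝ} (h₁ : Continuous f₁) (h₂ : Continuous f₂) (hg : Continuous g) :
    l2 (fun x => f₁ x - f₂ x) g = l2 f₁ g - l2 f₂ g := by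
  simp only [l2, sub_mul]
  exact intervalIntegral.integral_sub (Continuous.intervalIntegrable (by fun_prop) _ _)
    (Continuous.intervalIntegrable (by fun_prop) _ _)

theorem l2_const_mul_left (c : ℝ) (f g : ℝ → ℝ) : l2 (fun x => c * f x) g = c * l2 f g := by
  simp only [l2, mul_assoc, intervalIntegral.integral_const_mul]

theorem l2_add_right {f g₁ g₂ : ℝ → ℝ} (hf : Continuous f) (h₁ : Continuous g₁)
    (h₂ : Continuous g₂) : l2 f (fun x => g₁ x + g₂ x) = l2 f g₁ + l2 f g₂ := by
  rw [l2_comm, l2_add_left h₁ h₂ hf, l2_comm, l2_comm g₂]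

theorem l2_sub_right {f g₁ g₂ : ℝ → ℝ} (hf : Continuous f) (h₁ : Continuous g₁)
    (h₂ : Continuous g₂) : l2 f (fun x => g₁ x - g₂ x) = l2 f g₁ - l2 f g₂ := by
  rw [l2_comm, l2_sub_left h₁ h₂ hf, l2_comm, l2_comm g₂]

theorem l2_const_mul_right (c : ℝ) (f g : ℝ → ℝ) : l2 f (fun x => c * g x) = c * l2 f g := by
  rw [l2_comm, l2_const_mul_left, l2_comm]

theorem l2_self_nonneg (f : ℝ → ℝ) : 0 ≤ l2 f f :=
  intervalIntegral.integral_nonneg zero_le_one fun _ _ => mul_self_nonneg _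

theorem l2_self_add {f g : ℝ → ℝ} (hf : Continuous f) (hg : Continuous g) :
    l2 (fun x => f x + g x) (fun x => f x + g x) = l2 f f + 2 * l2 f g + l2 g g := by
  rw [l2_add_left hf hg (by fun_prop), l2_add_right hf hf hg, l2_add_right hg hf hg, l2_comm g f]
  ring

theorem l2_self_sub {f g : ℝ → ℝ} (hf : Continuous f) (hg : Continuous g) :
    l2 (fun x => f x - g x) (fun x => f x - g x) = l2 f f - 2 * l2 f g + l2 g g := by
  rw [l2_sub_left hf hg (by fun_prop), l2_sub_right hf hf hg, l2_sub_right hg hf hg, l2_comm g f]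
  ring

theorem l2_cauchySchwarz {f g : ℝ → ℝ} (hf : Continuous f) (hg : Continuous g) :
    l2 f g ^ 2 ≤ l2 f f * l2 g g := by
  have h : ∀ c : ℝ, 0 ≤ l2 g g * (c * c) + (2 * l2 f g) * c + l2 f f := by
    intro c
    have := l2_self_nonneg (fun x => f x + c * g x)
    rw [l2_self_add hf (by fun_prop), l2_const_mul_right, l2_const_mul_left, l2_const_mul_right]
      at this
    linarith
  have := discrim_le_zero h
  rw [discrim] at this
  linarith

theorem l2_self_le_of_abs_le {f : ℝ → ℝ} (hf : Continuous f) {M : ℝ}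
    (h : ∀ x ∈ Set.Icc (0 : ℝ) 1, |f x| ≤ M) : l2 f f ≤ M ^ 2 := by
  have h1 : l2 f f ≤ ∫ _ in (0 : ℝ)..1, M ^ 2 := by
    refine intervalIntegral.integral_mono_on zero_le_one
      (Continuous.intervalIntegrable (by fun_prop) _ _) (by simp) fun x hx => ?_
    rw [← sq, ← sq_abs]
    exact pow_le_pow_left₀ (abs_nonneg _) (h x hx) 2
  simpa using h1

/-- Integration by parts. -/
theorem l2_deriv_right {u v u' v' : ℝ → ℝ} (hu : ∀ x, HasDerivAt u (u' x) x)
    (hv : ∀ x, HasDerivAt v (v' x) x) (hu' : Continuous u') (hv' : Continuous v') :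
    l2 u v' = u 1 * v 1 - u 0 * v 0 - l2 u' v :=
  intervalIntegral.integral_mul_deriv_eq_deriv_mul (fun x _ => hu x) (fun x _ => hv x)
    (hu'.intervalIntegrable _ _) (hv'.intervalIntegrable _ _)

theorem l2_one_deriv {v v' : ℝ → ℝ} (hv : ∀ x, HasDerivAt v (v' x) x) (hv' : Continuous v') :
    l2 (fun _ => 1) v' = v 1 - v 0 := by
  rw [l2_deriv_right (u' := fun _ => 0) (fun x => hasDerivAt_const x 1) hv continuous_const hv']
  simp [l2]

/-- A Poincaré inequality. -/
theorem l2_self_le_deriv {w w' : ℝ → ℝ} (hw : ∀ x, HasDerivAt w (w' x) x) (hw' : Continuous w')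
    (h0 : w 0 = 0) : l2 w w ≤ 4 * l2 w' w' := by
  have hwc : Continuous w := continuous_iff_continuousAt.2 fun x => (hw x).continuousAt
  -- Integrate w² against (x − 1)': both boundary terms vanish, since w(0) = 0 and x − 1 vanishes at
  -- 1. Young's inequality then absorbs half of ‖w‖².
  have h1 := l2_deriv_right (u := fun x => w x * w x) (v := fun x => x - 1)
    (u' := fun x => w' x * w x + w x * w' x) (v' := fun _ => 1) (fun x => (hw x).mul (hw x))
    (fun x => by simpa using (hasDerivAt_id x).sub_const 1) (by fun_prop) continuous_const
  simp only [h0] at h1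
  have e1 : l2 (fun x => w x * w x) (fun _ => 1) = l2 w w := by simp [l2]
  have h2 : -l2 (fun x => w' x * w x + w x * w' x) (fun x => x - 1) ≤
      ∫ x in (0 : ℝ)..1, ((1 / 2) * (w x * w x) + 2 * (w' x * w' x)) := by
    rw [l2, ← intervalIntegral.integral_neg]
    refine intervalIntegral.integral_mono_on zero_le_one
      (Continuous.intervalIntegrable (by fun_prop) _ _)
      (Continuous.intervalIntegrable (by fun_prop) _ _) fun x hx => ?_
    obtain ⟨hx0, hx1⟩ := hx
    have a1 : 0 ≤ (w x * (1 / 2) - w' x * (1 - x)) ^ 2 := sq_nonneg _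
    have a2 : w' x ^ 2 * (1 - x) ^ 2 ≤ w' x ^ 2 * 1 :=
      mul_le_mul_of_nonneg_left (by nlinarith) (sq_nonneg _)
    nlinarith
  rw [intervalIntegral.integral_add (Continuous.intervalIntegrable (by fun_prop) _ _)
    (Continuous.intervalIntegrable (by fun_prop) _ _), intervalIntegral.integral_const_mul,
    intervalIntegral.integral_const_mul] at h2
  have e2 : ∫ x in (0 : ℝ)..1, w x * w x = l2 w w := rfl
  have e3 : ∫ x in (0 : ℝ)..1, w' x * w' x = l2 w' w' := rfl
  rw [e2, e3] at h2
  linarith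

theorem polyInner_derivative_right (P Q : ℝ[X]) :
    polyInner P Q.derivative = P.eval 1 * Q.eval 1 - P.eval 0 * Q.eval 0 -
      polyInner P.derivative Q :=
  l2_deriv_right (fun x => P.hasDerivAt x) (fun x => Q.hasDerivAt x) (by fun_prop) (by fun_prop)

theorem polyInner_self_nonneg (P : ℝ[X]) : 0 ≤ polyInner P P := l2_self_nonneg _

theorem polyInner_cauchySchwarz (P Q : ℝ[X]) :
    polyInner P Q ^ 2 ≤ polyInner P P * polyInner Q Q :=
  l2_cauchySchwarz P.continuous Q.continuous

theorem polyInner_self_le_derivative {P : ℝ[X]} (h : P.eval 0 = 0) :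
    polyInner P P ≤ 4 * polyInner P.derivative P.derivative :=
  l2_self_le_deriv (fun x => P.hasDerivAt x) (by fun_prop) h

theorem eq_zero_of_polyInner_self_eq_zero {P : ℝ[X]} (h : polyInner P P = 0) : P = 0 := by
  have h1 : ∀ x ∈ Set.Ioo (0 : ℝ) 1, P.eval x = 0 := by
    intro x hx
    by_contra hne
    have : 0 < polyInner P P :=
      intervalIntegral.integral_pos zero_lt_one (by fun_prop) (fun y _ => mul_self_nonneg _)
        ⟨x, Set.Ioo_subset_Icc_self hx, mul_self_pos.2 hne⟩
    exact this.ne' h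
  exact Polynomial.eq_zero_of_infinite_isRoot P
    ((Set.Ioo_infinite (zero_lt_one (α := ℝ))).mono fun x hx => h1 x hx)

/-! ### Orthogonal polynomials -/

theorem polyInner_iterate_derivative {n : ℕ} {W : ℝ[X]}
    (h0 : ∀ k < n, (Polynomial.derivative^[k] W).eval 0 = 0)
    (h1 : ∀ k < n, (Polynomial.derivative^[k] W).eval 1 = 0) (Q : ℝ[X]) :
    polyInner (Polynomial.derivative^[n] W) Q =
      (-1) ^ n * polyInner W (Polynomial.derivative^[n] Q) := by
  induction n generalizing Q with
  | zero => simp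
  | succ n ih =>
    have hi := polyInner_derivative_right Q (Polynomial.derivative^[n] W)
    rw [h0 n (Nat.lt_succ_self n), h1 n (Nat.lt_succ_self n)] at hi
    rw [Function.iterate_succ_apply', polyInner_comm, hi, polyInner_comm,
      ih (fun k hk => h0 k (hk.trans (Nat.lt_succ_self n)))
        (fun k hk => h1 k (hk.trans (Nat.lt_succ_self n))), Function.iterate_succ_apply, pow_succ]
    ring

theorem integral_pow_mul_one_sub_pow (m n : ℕ) :
    ∫ x in (0 : ℝ)..1, x ^ m * (1 - x) ^ n =
      (m.factorial * n.factorial : ℝ) / (m + n + 1).factorial := by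
  induction n generalizing m with
  | zero =>
    simp only [pow_zero, mul_one, integral_pow, Nat.factorial_succ, Nat.factorial_zero, add_zero]
    have : (m.factorial : ℝ) ≠ 0 := by positivity
    push_cast
    field_simp
    simp
  | succ n ih =>
    have hm : (m : ℝ) + 1 ≠ 0 := by positivity
    have h1 := l2_deriv_right (u := fun x => (1 - x) ^ (n + 1)) (v := fun x => x ^ (m + 1) / (m + 1))
      (u' := fun x => -((n + 1) * (1 - x) ^ n)) (v' := fun x => x ^ m)
      (fun x => by
        have := ((hasDerivAt_const x (1 : ℝ)).sub (hasDerivAt_id x)).pow (n + 1)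
        refine this.congr_deriv ?_
        simp)
      (fun x => by
        refine ((hasDerivAt_pow (m + 1) x).div_const ((m : ℝ) + 1)).congr_deriv ?_
        push_cast
        field_simp) (by fun_prop) (by fun_prop)
    have e1 : l2 (fun x => (1 - x) ^ (n + 1)) (fun x => x ^ m) =
        ∫ x in (0 : ℝ)..1, x ^ m * (1 - x) ^ (n + 1) := by simp only [l2, mul_comm]
    have e2 : l2 (fun x => -((n + 1) * (1 - x) ^ n)) (fun x => x ^ (m + 1) / (m + 1)) =
        -((n + 1) / (m + 1)) * ∫ x in (0 : ℝ)..1, x ^ (m + 1) * (1 - x) ^ n := by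
      rw [l2, ← intervalIntegral.integral_const_mul]
      congr 1
      funext x
      field_simp
    rw [e1, e2, ih] at h1
    rw [h1, Nat.factorial_succ n, Nat.factorial_succ m, show m + 1 + n + 1 = m + (n + 1) + 1 by ring]
    push_cast
    field_simp
    simp

/-- The monic polynomial of degree `n` that is orthogonal to all polynomials of smaller degree, and
its norm. -/
theorem exists_monic_orthogonal (n : ℕ) :
    ∃ L : ℝ[X], L.Monic ∧ L.natDegree = n ∧ (∀ Q : ℝ[X], Q.degree < n → polyInner L Q = 0) ∧
      polyInner L L = (n.factorial : ℝ) ^ 4 / ((2 * n).factorial ^ 2 * (2 * n + 1)) := by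
  -- Rodrigues' formula: the n-th derivative of xⁿ(x − 1)ⁿ is orthogonal to lower degrees after n
  -- integrations by parts, and the constant `c` below makes it monic. Its norm reduces to a Beta
  -- integral.
  set W : ℝ[X] := (Polynomial.X ^ n) * (Polynomial.X - Polynomial.C 1) ^ n with hW
  have hWm : W.Monic := (Polynomial.monic_X_pow n).mul ((Polynomial.monic_X_sub_C 1).pow n)
  have hWd : W.natDegree = 2 * n := by
    rw [hW, (Polynomial.monic_X_pow n).natDegree_mul ((Polynomial.monic_X_sub_C (1 : ℝ)).pow n),
      Polynomial.natDegree_X_pow, (Polynomial.monic_X_sub_C (1 : ℝ)).natDegree_pow,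
      Polynomial.natDegree_X_sub_C]
    ring
  have hroot : ∀ k < n, ∀ P : ℝ[X], P ^ n ∣ W → ∀ x, P.eval x = 0 →
      (Polynomial.derivative^[k] W).eval x = 0 := by
    intro k hk P hP x hx
    have := Polynomial.pow_sub_dvd_iterate_derivative_of_pow_dvd k hP
    obtain ⟨R, hR⟩ := (dvd_pow_self P (by omega : n - k ≠ 0)).trans this
    rw [hR, Polynomial.eval_mul, hx, zero_mul]
  have h0 : ∀ k < n, (Polynomial.derivative^[k] W).eval 0 = 0 := fun k hk =>
    hroot k hk Polynomial.X (dvd_mul_right _ _) 0 (by simp)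
  have h1 : ∀ k < n, (Polynomial.derivative^[k] W).eval 1 = 0 := fun k hk =>
    hroot k hk (Polynomial.X - Polynomial.C 1) (dvd_mul_left _ _) 1 (by simp)
  have hparts := polyInner_iterate_derivative h0 h1
  set D : ℝ[X] := Polynomial.derivative^[n] W with hD
  have hn0 : (n.factorial : ℝ) ≠ 0 := by positivity
  have hn1 : ((2 * n).factorial : ℝ) ≠ 0 := by positivity
  have hDc : D.coeff n = (2 * n).factorial / n.factorial := by
    rw [hD, Polynomial.coeff_iterate_derivative]
    have e : W.coeff (n + n) = 1 := by
      rw [← two_mul, ← hWd]; exact hWm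
    rw [e, nsmul_eq_mul, mul_one, eq_div_iff hn0, ← two_mul]
    have := Nat.factorial_mul_descFactorial (show n ≤ 2 * n by omega)
    rw [show 2 * n - n = n by omega, mul_comm] at this
    exact_mod_cast this
  have hDd : D.natDegree ≤ n := by
    refine (Polynomial.natDegree_iterate_derivative W n).trans ?_
    omega
  set c : ℝ := n.factorial / (2 * n).factorial with hc
  have hLc : (Polynomial.C c * D).coeff n = 1 := by
    rw [Polynomial.coeff_C_mul, hDc, hc]
    field_simp
  have hLd : (Polynomial.C c * D).natDegree ≤ n := (Polynomial.natDegree_C_mul_le _ _).trans hDd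
  have hLd' : (Polynomial.C c * D).natDegree = n :=
    le_antisymm hLd (Polynomial.le_natDegree_of_ne_zero (by rw [hLc]; exact one_ne_zero))
  have hLm : (Polynomial.C c * D).Monic := by
    rw [Polynomial.Monic, Polynomial.leadingCoeff, hLd', hLc]
  have horth : ∀ Q : ℝ[X], polyInner (Polynomial.C c * D) Q =
      c * ((-1) ^ n * polyInner W (Polynomial.derivative^[n] Q)) := by
    intro Q
    rw [← hparts Q, ← Polynomial.smul_eq_C_mul, map_smul, LinearMap.smul_apply, smul_eq_mul]
  refine ⟨Polynomial.C c * D, hLm, hLd', ?_, ?_⟩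
  · intro Q hQ
    have : Polynomial.derivative^[n] Q = 0 :=
      Polynomial.iterate_derivative_eq_zero_of_degree_lt hQ
    rw [horth, this, map_zero, mul_zero, mul_zero]
  · have hder : Polynomial.derivative^[n] (Polynomial.C c * D) = Polynomial.C (n.factorial : ℝ) := by
      have h2 : (Polynomial.derivative^[n] (Polynomial.C c * D)).natDegree ≤ 0 := by
        refine (Polynomial.natDegree_iterate_derivative _ n).trans ?_
        omega
      rw [Polynomial.eq_C_of_natDegree_le_zero h2, Polynomial.coeff_iterate_derivative]
      simp [hLc, Nat.descFactorial_self]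
    rw [horth, hder, polyInner_apply]
    have e : ∀ x : ℝ, W.eval x * (Polynomial.C (n.factorial : ℝ)).eval x =
        ((-1) ^ n * n.factorial) * (x ^ n * (1 - x) ^ n) := by
      intro x
      simp only [hW, Polynomial.eval_mul, Polynomial.eval_pow, Polynomial.eval_X,
        Polynomial.eval_sub, Polynomial.eval_C]
      rw [show x - 1 = (-1) * (1 - x) by ring, mul_pow]
      ring
    simp only [e, intervalIntegral.integral_const_mul, integral_pow_mul_one_sub_pow]
    have hs : ((-1 : ℝ) ^ n) * (-1) ^ n = 1 := by rw [← mul_pow]; simp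
    rw [show n + n + 1 = 2 * n + 1 by ring, Nat.factorial_succ, hc]
    push_cast
    field_simp
    rw [sq]
    exact hs

theorem degree_sub_lt_of_coeff_eq {n : ℕ} {P Q : ℝ[X]} (hP : P.natDegree ≤ n) (hQ : Q.natDegree ≤ n)
    (h : P.coeff n = Q.coeff n) : (P - Q).degree < n := by
  rw [Polynomial.degree_lt_iff_coeff_zero]
  intro m hm
  rcases hm.lt_or_eq with hm | rfl
  · rw [Polynomial.coeff_sub, Polynomial.coeff_eq_zero_of_natDegree_lt (hP.trans_lt hm),
      Polynomial.coeff_eq_zero_of_natDegree_lt (hQ.trans_lt hm), sub_zero]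
  · rw [Polynomial.coeff_sub, h, sub_self]

/-- Gram–Schmidt: raising the degree by one adds the component of f along the next orthogonal
polynomial. -/
theorem exists_projection {f : ℝ → ℝ} (hf : Continuous f) (n : ℕ) :
    ∃ P : ℝ[X], P.degree < n ∧ ∀ Q : ℝ[X], Q.degree < n →
      l2 f (fun x => Q.eval x) = polyInner P Q := by
  induction n with
  | zero =>
    refine ⟨0, by simp, fun Q hQ => ?_⟩
    have : Q = 0 := by simpa using hQ
    simp [this, l2]
  | succ n ih =>
    obtain ⟨P, hP, hPQ⟩ := ih
    obtain ⟨L, hLm, hLd, hL, -⟩ := exists_monic_orthogonal n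
    have hLn : polyInner L L ≠ 0 := fun h0 => hLm.ne_zero (eq_zero_of_polyInner_self_eq_zero h0)
    set α : ℝ := l2 f (fun x => L.eval x) / polyInner L L with hα
    have hdegL : (α • L).degree < (n + 1 : ℕ) := by
      refine (Polynomial.degree_smul_le _ _).trans_lt ?_
      rw [Polynomial.degree_eq_natDegree hLm.ne_zero, hLd]
      exact_mod_cast Nat.lt_succ_self n
    refine ⟨P + α • L, (Polynomial.degree_add_le _ _).trans_lt (max_lt (hP.trans ?_) hdegL), ?_⟩
    · exact_mod_cast Nat.lt_succ_self n
    intro Q hQ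
    have hQn : Q.natDegree ≤ n := Polynomial.natDegree_le_iff_coeff_eq_zero.2 fun m hm =>
      Polynomial.coeff_eq_zero_of_degree_lt (hQ.trans_le (by exact_mod_cast hm))
    have hR := degree_sub_lt_of_coeff_eq (Q := Q.coeff n • L) hQn
      ((Polynomial.natDegree_smul_le _ _).trans hLd.le)
      (by rw [Polynomial.coeff_smul, ← hLd, hLm.coeff_natDegree, smul_eq_mul, mul_one])
    set R : ℝ[X] := Q - Q.coeff n • L with hRdef
    have hQe : Q = Q.coeff n • L + R := by rw [hRdef]; ring
    have e1 : l2 f (fun x => Q.eval x) = Q.coeff n * l2 f (fun x => L.eval x) +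
        l2 f (fun x => R.eval x) := by
      conv_lhs => rw [hQe]
      simp only [Polynomial.eval_add, Polynomial.eval_smul, smul_eq_mul]
      rw [l2_add_right hf (by fun_prop) (by fun_prop), l2_const_mul_right]
    have e2 : polyInner (P + α • L) Q = Q.coeff n * α * polyInner L L + polyInner P R := by
      conv_lhs => rw [hQe]
      simp only [map_add, LinearMap.add_apply, map_smul, LinearMap.smul_apply, smul_eq_mul, hL R hR,
        polyInner_comm P L, hL P hP]
      ring
    rw [e1, e2, hPQ R hR, hα]
    field_simp

/-- By Pythagoras, L has the least norm among monic polynomials of its degree. This turns L² bounds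
into bounds on top coefficients. -/
theorem sq_coeff_mul_le {n : ℕ} {L P : ℝ[X]} (hLm : L.Monic) (hLd : L.natDegree = n)
    (hL : ∀ Q : ℝ[X], Q.degree < n → polyInner L Q = 0) (hP : P.natDegree ≤ n) :
    P.coeff n ^ 2 * polyInner L L ≤ polyInner P P := by
  have hR := degree_sub_lt_of_coeff_eq (Q := P.coeff n • L) hP
    ((Polynomial.natDegree_smul_le _ _).trans hLd.le)
    (by rw [Polynomial.coeff_smul, ← hLd, hLm.coeff_natDegree, smul_eq_mul, mul_one])
  set R : ℝ[X] := P - P.coeff n • L with hRdef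
  have hPe : P = P.coeff n • L + R := by rw [hRdef]; ring
  have e : polyInner P P = P.coeff n ^ 2 * polyInner L L + polyInner R R := by
    conv_lhs => rw [hPe]
    simp only [map_add, LinearMap.add_apply, map_smul, LinearMap.smul_apply, smul_eq_mul, hL R hR,
      polyInner_comm R L]
    ring
  rw [e]
  linarith [polyInner_self_nonneg R]

theorem exists_antiderivative (n : ℕ) (P : ℝ[X]) (hP : P.degree < n) (v : ℝ) :
    ∃ A : ℝ[X], A.natDegree ≤ n ∧ A.derivative = P ∧ A.eval 0 = v := by
  refine ⟨Polynomial.C v + ∑ i ∈ Finset.range n, Polynomial.monomial (i + 1) (P.coeff i / (i + 1)),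
    ?_, ?_, ?_⟩
  · refine (Polynomial.natDegree_add_le _ _).trans (max_le (by simp) ?_)
    refine Polynomial.natDegree_sum_le_of_forall_le _ _ fun i hi => ?_
    exact (Polynomial.natDegree_monomial_le _).trans (Finset.mem_range.1 hi)
  · rw [Polynomial.derivative_add, Polynomial.derivative_C, zero_add, Polynomial.derivative_sum]
    have : ∀ i : ℕ, Polynomial.derivative (Polynomial.monomial (i + 1) (P.coeff i / (i + 1))) =
        Polynomial.monomial i (P.coeff i) := by
      intro i
      rw [Polynomial.derivative_monomial]
      congr 1
      have : (i : ℝ) + 1 ≠ 0 := by positivity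
      push_cast
      field_simp
    simp only [this]
    by_cases h0 : P = 0
    · simp [h0]
    · exact (P.as_sum_range' n ((Polynomial.natDegree_lt_iff_degree_lt h0).2 hP)).symm
  · simp [Polynomial.eval_finsetSum]

/-! ### End-point interpolation with projected derivative -/

/-- The interpolant of `f` at the end points of the reference element whose derivative is the
`L²` projection of the derivative `g` of `f`. -/
structure IsProjection (p : ℕ) (f g : ℝ → ℝ) (A : ℝ[X]) : Prop where
  natDegree_le : A.natDegree ≤ p
  eval_zero : A.eval 0 = f 0
  eval_one : A.eval 1 = f 1
  orthogonal : ∀ Q : ℝ[X], Q.degree < p →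
    l2 (fun x => g x - A.derivative.eval x) (fun x => Q.eval x) = 0

theorem exists_isProjection {p : ℕ} (hp : 1 ≤ p) {f g : ℝ → ℝ} (hf : ∀ x, HasDerivAt f (g x) x)
    (hg : Continuous g) : ∃ A, IsProjection p f g A := by
  obtain ⟨P, hP, hPQ⟩ := exists_projection hg p
  obtain ⟨A, hA, hA', hA0⟩ := exists_antiderivative p P hP (f 0)
  refine ⟨A, hA, hA0, ?_, fun Q hQ => ?_⟩
  · have h1 := hPQ 1 (by rw [Polynomial.degree_one]; exact_mod_cast hp)
    have h2 := l2_one_deriv hf hg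
    have h3 := l2_one_deriv (fun x => A.hasDerivAt x) (by fun_prop)
    rw [polyInner_eq_l2, ← hA', l2_comm, l2_comm (fun x => A.derivative.eval x)] at h1
    simp only [Polynomial.eval_one] at h1
    rw [h2, h3] at h1
    linarith
  · rw [l2_sub_left hg (by fun_prop) (by fun_prop), hPQ Q hQ, hA', polyInner_eq_l2, sub_self]

theorem degree_derivative_lt {p : ℕ} {A : ℝ[X]} (hA : A.natDegree ≤ p) :
    A.derivative.degree < p := by
  rw [Polynomial.degree_lt_iff_coeff_zero]
  intro m hm
  rw [Polynomial.coeff_derivative, Polynomial.coeff_eq_zero_of_natDegree_lt (by omega), zero_mul]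

namespace IsProjection

variable {p : ℕ} {f g : ℝ → ℝ} {A : ℝ[X]} {θ : ℝ}

theorem polyInner_derivative (h : IsProjection p f g A) (hg : Continuous g) :
    polyInner A.derivative A.derivative = l2 g g -
      l2 (fun x => g x - A.derivative.eval x) (fun x => g x - A.derivative.eval x) := by
  have h0 := h.orthogonal _ (degree_derivative_lt h.natDegree_le)
  rw [l2_sub_left hg (by fun_prop) (by fun_prop)] at h0
  rw [l2_self_sub hg (by fun_prop), polyInner_eq_l2]
  linarith

/-- Duality: f − A vanishes at both ends and −f'' = θ²f, so θ²(f, f − A) = (g, g − A') = ‖g − A'‖²,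
the last step by orthogonality. -/
theorem polyInner_self (h : IsProjection p f g A) (hf : ∀ x, HasDerivAt f (g x) x)
    (hg : ∀ x, HasDerivAt g (-θ ^ 2 * f x) x) :
    θ ^ 2 * polyInner A A = θ ^ 2 * l2 f f -
      2 * l2 (fun x => g x - A.derivative.eval x) (fun x => g x - A.derivative.eval x) +
      θ ^ 2 * l2 (fun x => f x - A.eval x) (fun x => f x - A.eval x) := by
  have hfc : Continuous f := continuous_iff_continuousAt.2 fun x => (hf x).continuousAt
  have hgc : Continuous g := continuous_iff_continuousAt.2 fun x => (hg x).continuousAt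
  have h0 := h.orthogonal _ (degree_derivative_lt h.natDegree_le)
  have h1 := l2_deriv_right (u := fun x => f x - A.eval x) (fun x => (hf x).sub (A.hasDerivAt x)) hg
    (by fun_prop) (by fun_prop)
  simp only [h.eval_zero, h.eval_one, sub_self, zero_mul, zero_sub] at h1
  rw [l2_const_mul_right] at h1
  have h2 : l2 (fun x => g x - A.derivative.eval x) g =
      l2 (fun x => g x - A.derivative.eval x) (fun x => g x - A.derivative.eval x) := by
    rw [l2_sub_right (by fun_prop) hgc (by fun_prop), h0, sub_zero]
  rw [h2, l2_sub_left hfc (by fun_prop) hfc] at h1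
  rw [l2_self_sub hfc (by fun_prop), polyInner_eq_l2, l2_comm f (fun x => A.eval x)]
  linarith

theorem l2_error_le (h : IsProjection p f g A) (hf : ∀ x, HasDerivAt f (g x) x)
    (hg : Continuous g) :
    l2 (fun x => f x - A.eval x) (fun x => f x - A.eval x) ≤
      4 * l2 (fun x => g x - A.derivative.eval x) (fun x => g x - A.derivative.eval x) :=
  l2_self_le_deriv (fun x => (hf x).sub (A.hasDerivAt x)) (by fun_prop) (by simp [h.eval_zero])

/-- As w' has degree below p, A' may be replaced by g; integration by parts then uses −g' = θ²f. The
failure of A to solve the equation against bubbles is thus only θ²(f − A, w). -/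
theorem polyInner_bubble (h : IsProjection p f g A) (hf : ∀ x, HasDerivAt f (g x) x)
    (hg : ∀ x, HasDerivAt g (-θ ^ 2 * f x) x) {w : ℝ[X]} (hw : w.natDegree ≤ p)
    (hw0 : w.eval 0 = 0) (hw1 : w.eval 1 = 0) :
    polyInner A.derivative w.derivative =
      θ ^ 2 * (polyInner A w + l2 (fun x => f x - A.eval x) (fun x => w.eval x)) := by
  have hfc : Continuous f := continuous_iff_continuousAt.2 fun x => (hf x).continuousAt
  have hgc : Continuous g := continuous_iff_continuousAt.2 fun x => (hg x).continuousAt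
  have h0 := h.orthogonal _ (degree_derivative_lt hw)
  rw [l2_sub_left hgc (by fun_prop) (by fun_prop)] at h0
  have h1 := l2_deriv_right hg (fun x => w.hasDerivAt x) (by fun_prop) (by fun_prop)
  simp only [hw0, hw1, mul_zero, sub_zero, zero_sub] at h1
  rw [l2_const_mul_left] at h1
  rw [l2_sub_left hfc (by fun_prop) (by fun_prop), polyInner_eq_l2, polyInner_eq_l2]
  linarith

/-- Comparison of the projection with a polynomial `T` of degree at most `p` close to `g`. -/
theorem compare (h : IsProjection p f g A) (hg : Continuous g) {L T : ℝ[X]} {a M : ℝ}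
    (hLm : L.Monic) (hLd : L.natDegree = p)
    (hL : ∀ Q : ℝ[X], Q.degree < p → polyInner L Q = 0) (hT : T.natDegree ≤ p) (hTa : T.coeff p = a)
    (hM : ∀ x ∈ Set.Icc (0 : ℝ) 1, |g x - T.eval x| ≤ M) :
    |l2 (fun x => g x - A.derivative.eval x) (fun x => g x - A.derivative.eval x) -
        a ^ 2 * polyInner L L| ≤ 2 * |a| * (polyInner L L + 1) * M + M ^ 2 ∧
      polyInner (A.derivative - (T - a • L)) (A.derivative - (T - a • L)) ≤ M ^ 2 := by
  have hM0 : 0 ≤ M := (abs_nonneg _).trans (hM 0 (by simp))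
  have hTL : (T - a • L).degree < p := degree_sub_lt_of_coeff_eq hT
    ((Polynomial.natDegree_smul_le _ _).trans hLd.le)
    (by rw [Polynomial.coeff_smul, ← hLd, hLm.coeff_natDegree, smul_eq_mul, mul_one, hLd, hTa])
  set z : ℝ[X] := A.derivative - (T - a • L) with hz
  have hzd : z.degree < p := (Polynomial.degree_sub_le _ _).trans_lt
    (max_lt (degree_derivative_lt h.natDegree_le) hTL)
  -- The error splits as g − T = y + z with y orthogonal to degree < p and z of degree < p, so ‖y‖²
  -- + ‖z‖² = ‖g − T‖² ≤ M². Both claims follow, since g − A' = aL + y.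
  set y : ℝ → ℝ := fun x => (g x - A.derivative.eval x) - a * L.eval x with hy
  have hyc : Continuous y := by fun_prop
  have hgT : (fun x => g x - T.eval x) = fun x => y x + z.eval x := by
    funext x
    simp only [hy, hz, Polynomial.eval_sub, Polynomial.eval_smul, smul_eq_mul]
    ring
  have hyz : l2 y (fun x => z.eval x) = 0 := by
    rw [hy, l2_sub_left (by fun_prop) (by fun_prop) (by fun_prop), h.orthogonal z hzd,
      l2_const_mul_left, ← polyInner_eq_l2, hL z hzd]
    ring
  have hsum : l2 y y + polyInner z z ≤ M ^ 2 := by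
    have := l2_self_le_of_abs_le (by fun_prop) hM
    rw [hgT, l2_self_add hyc (by fun_prop), hyz] at this
    rw [polyInner_eq_l2]
    linarith
  have hyy : l2 y y ≤ M ^ 2 := by linarith [polyInner_self_nonneg z]
  refine ⟨?_, by linarith [l2_self_nonneg y]⟩
  have hρ : (fun x => g x - A.derivative.eval x) = fun x => a * L.eval x + y x := by
    funext x
    simp only [hy]
    ring
  have hLL : 0 ≤ polyInner L L := polyInner_self_nonneg L
  have hLy : |l2 (fun x => L.eval x) y| ≤ (polyInner L L + 1) * M := by
    refine abs_le_of_sq_le_sq ?_ (by positivity)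
    calc _ ≤ polyInner L L * l2 y y := l2_cauchySchwarz (by fun_prop) hyc
      _ ≤ polyInner L L * M ^ 2 := mul_le_mul_of_nonneg_left hyy hLL
      _ ≤ (polyInner L L + 1) ^ 2 * M ^ 2 := mul_le_mul_of_nonneg_right (by nlinarith) (sq_nonneg M)
      _ = _ := by ring
  rw [hρ, l2_self_add (by fun_prop) hyc, l2_const_mul_left, l2_const_mul_left, l2_const_mul_right,
    ← polyInner_eq_l2]
  have e : a * (a * polyInner L L) + 2 * (a * l2 (fun x => L.eval x) y) + l2 y y -
      a ^ 2 * polyInner L L = 2 * (a * l2 (fun x => L.eval x) y) + l2 y y := by ring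
  rw [e]
  refine (abs_add_le _ _).trans (add_le_add ?_ ?_)
  · rw [abs_mul, abs_mul, abs_two]
    calc 2 * (|a| * |l2 (fun x => L.eval x) y|) ≤ 2 * (|a| * ((polyInner L L + 1) * M)) := by gcongr
      _ = _ := by ring
  · rw [abs_of_nonneg (l2_self_nonneg y)]
    exact hyy

end IsProjection

theorem topDeriv_eq_coeff_derivative (n : ℕ) (A : ℝ[X]) :
    topDeriv (n + 1) A = n.factorial * A.derivative.coeff n := by
  rw [topDeriv_apply, Polynomial.coeff_derivative, Nat.factorial_succ]
  push_cast
  ring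

/-! ### Plane waves -/

/-- The real part of the plane wave `c e^{iθx}`. -/
def wave (θ : ℝ) (c : ℂ) (x : ℝ) : ℝ := (c * Complex.exp (Complex.I * θ * x)).re

theorem hasDerivAt_wave (θ : ℝ) (c : ℂ) (x : ℝ) :
    HasDerivAt (wave θ c) (wave θ (Complex.I * θ * c) x) x := by
  have h1 : HasDerivAt (fun y : ℝ => Complex.I * θ * (y : ℂ)) (Complex.I * θ) x := by
    simpa using (Complex.ofRealCLM.hasDerivAt (x := x)).const_mul (Complex.I * θ)
  have h2 := Complex.reCLM.hasFDerivAt.comp_hasDerivAt x (h1.cexp.const_mul c)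
  refine h2.congr_deriv ?_
  simp only [wave, Complex.reCLM_apply]
  ring_nf

theorem hasDerivAt_wave_deriv (θ : ℝ) (c : ℂ) (x : ℝ) :
    HasDerivAt (wave θ (Complex.I * θ * c)) (-θ ^ 2 * wave θ c x) x := by
  refine (hasDerivAt_wave θ _ x).congr_deriv ?_
  have : Complex.I * θ * (Complex.I * θ * c) * Complex.exp (Complex.I * θ * x) =
      ((-θ ^ 2 : ℝ) : ℂ) * (c * Complex.exp (Complex.I * θ * x)) := by
    push_cast
    linear_combination (c * Complex.exp (Complex.I * θ * x) * θ ^ 2) * Complex.I_sq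
  rw [wave, this, Complex.re_ofReal_mul, wave]

theorem continuous_wave (θ : ℝ) (c : ℂ) : Continuous (wave θ c) :=
  continuous_iff_continuousAt.2 fun x => (hasDerivAt_wave θ c x).continuousAt

/-- The imaginary part of a plane wave is again a `wave`, so one family serves both parts. -/
theorem wave_neg_I_mul (θ : ℝ) (c : ℂ) (x : ℝ) :
    wave θ (-Complex.I * c) x = (c * Complex.exp (Complex.I * θ * x)).im := by
  rw [wave, mul_assoc]
  simp

theorem l2_wave_add (θ : ℝ) (c : ℂ) :
    l2 (wave θ c) (wave θ c) + l2 (wave θ (-Complex.I * c)) (wave θ (-Complex.I * c)) =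
      Complex.normSq c := by
  have hA := continuous_wave θ c
  have hB := continuous_wave θ (-Complex.I * c)
  rw [l2, l2, ← intervalIntegral.integral_add (Continuous.intervalIntegrable (by fun_prop) _ _)
    (Continuous.intervalIntegrable (by fun_prop) _ _)]
  have : ∀ x : ℝ, wave θ c x * wave θ c x + wave θ (-Complex.I * c) x * wave θ (-Complex.I * c) x =
      Complex.normSq c := by
    intro x
    rw [wave_neg_I_mul, wave, ← Complex.normSq_apply, map_mul, Complex.normSq_eq_norm_sq,
      Complex.normSq_eq_norm_sq, Complex.norm_exp]
    simp
  simp only [this]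
  simp

theorem wave_one (θ : ℝ) (c : ℂ) : wave θ c 1 =
    Real.cos θ * wave θ c 0 - Real.sin θ * wave θ (-Complex.I * c) 0 := by
  rw [wave_neg_I_mul, wave, wave, mul_comm Complex.I, Complex.ofReal_one, mul_one, Complex.exp_mul_I,
    ← Complex.ofReal_cos, ← Complex.ofReal_sin]
  simp [Complex.cos_ofReal_re, Complex.sin_ofReal_re]
  ring

theorem wave_neg_I_mul_one (θ : ℝ) (c : ℂ) : wave θ (-Complex.I * c) 1 =
    Real.sin θ * wave θ c 0 + Real.cos θ * wave θ (-Complex.I * c) 0 := by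
  rw [wave_neg_I_mul, wave_neg_I_mul, wave, mul_comm Complex.I, Complex.ofReal_one, mul_one,
    Complex.exp_mul_I, ← Complex.ofReal_cos, ← Complex.ofReal_sin]
  simp [Complex.cos_ofReal_re, Complex.sin_ofReal_re]
  ring

theorem wave_zero_sq_add (θ : ℝ) (c : ℂ) :
    wave θ c 0 ^ 2 + wave θ (-Complex.I * c) 0 ^ 2 = Complex.normSq c := by
  rw [wave_neg_I_mul, wave]
  simp [Complex.normSq_apply, sq]

/-- The Taylor polynomial of `wave θ c` with `N` terms. -/
def waveTaylor (θ : ℝ) (c : ℂ) (N : ℕ) : ℝ[X] :=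
  ∑ m ∈ Finset.range N, Polynomial.monomial m ((c * (Complex.I * θ) ^ m).re / m.factorial)

theorem coeff_waveTaylor (θ : ℝ) (c : ℂ) (N m : ℕ) : (waveTaylor θ c N).coeff m =
    if m < N then (c * (Complex.I * θ) ^ m).re / m.factorial else 0 := by
  simp only [waveTaylor, Polynomial.finsetSum_coeff, Polynomial.coeff_monomial, Finset.sum_ite_eq',
    Finset.mem_range]

theorem natDegree_waveTaylor_le (θ : ℝ) (c : ℂ) (N : ℕ) : (waveTaylor θ c (N + 1)).natDegree ≤ N :=
  Polynomial.natDegree_le_iff_coeff_eq_zero.2 fun m hm => by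
    rw [coeff_waveTaylor, if_neg (by omega)]

/-- A vanishing Taylor term improves the remainder by one power of θ at no cost in degree. -/
theorem waveTaylor_succ_of_eq_zero {θ : ℝ} {c : ℂ} {N : ℕ} (h : (c * (Complex.I * θ) ^ N).re = 0) :
    waveTaylor θ c (N + 1) = waveTaylor θ c N := by
  rw [waveTaylor, Finset.sum_range_succ, h, zero_div, Polynomial.monomial_zero_right, add_zero,
    waveTaylor]

theorem abs_wave_sub_waveTaylor_le {θ : ℝ} (hθ : 0 < θ) (hθ1 : θ ≤ 1) (c : ℂ) (N : ℕ) {x : ℝ}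
    (hx : x ∈ Set.Icc (0 : ℝ) 1) :
    |wave θ c x - (waveTaylor θ c N).eval x| ≤ 3 * ‖c‖ * θ ^ N := by
  have h1 := Complex.norm_exp_sub_sum_le_norm_mul_exp (Complex.I * θ * x) N
  have h2 : ‖Complex.I * θ * x‖ = θ * x := by
    simp [abs_of_pos hθ, abs_of_nonneg hx.1]
  rw [h2] at h1
  have h3 : θ * x ≤ θ := mul_le_of_le_one_right hθ.le hx.2
  have h0 : 0 ≤ θ * x := mul_nonneg hθ.le hx.1
  have h4 : Real.exp (θ * x) ≤ 3 :=
    (Real.exp_le_exp.2 (h3.trans hθ1)).trans (Real.exp_one_lt_d9.le.trans (by norm_num))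
  have h5 : wave θ c x - (waveTaylor θ c N).eval x =
      (c * (Complex.exp (Complex.I * θ * x) -
        ∑ m ∈ Finset.range N, (Complex.I * θ * x) ^ m / m.factorial)).re := by
    rw [mul_sub, Complex.sub_re, Finset.mul_sum, Complex.re_sum, wave, waveTaylor,
      Polynomial.eval_finsetSum]
    congr 1
    refine Finset.sum_congr rfl fun m _ => ?_
    have : c * ((Complex.I * θ * x) ^ m / m.factorial) =
        c * (Complex.I * θ) ^ m * ((x ^ m / m.factorial : ℝ) : ℂ) := by
      push_cast
      rw [mul_pow (Complex.I * θ)]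
      ring
    rw [this, Complex.re_mul_ofReal, Polynomial.eval_monomial]
    ring
  rw [h5]
  refine (Complex.abs_re_le_norm _).trans ?_
  rw [norm_mul]
  calc _ ≤ ‖c‖ * ((θ * x) ^ N * Real.exp (θ * x)) := by gcongr
    _ ≤ ‖c‖ * (θ ^ N * 3) := by gcongr
    _ = _ := by ring

/-! ### The quasimode -/

/-- The leading coefficient of the dispersion error. -/
def dispersionConst (p : ℕ) : ℝ :=
  1 / (2 * (p : ℝ) + 1) * ((p.factorial : ℝ) / ((2 * p).factorial : ℝ)) ^ 2

set_option maxHeartbeats 1000000 in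
/-- The Bloch pair obtained by projecting the plane wave with phase `θ`. -/
theorem exists_quasimode (n : ℕ) : ∃ K > (0 : ℝ), ∀ θ : ℝ, 0 < θ → θ ≤ 1 →
    ∃ (A B : ℝ[X]) (E R : ℝ), A.natDegree ≤ n + 1 ∧ B.natDegree ≤ n + 1 ∧ BlochPair θ A B ∧
      A.eval 0 ^ 2 + B.eval 0 ^ 2 = 1 ∧
      polyInner A.derivative A.derivative + polyInner B.derivative B.derivative = θ ^ 2 - E ∧
      θ ^ 2 * (polyInner A A + polyInner B B) = θ ^ 2 - 2 * E + θ ^ 2 * R ∧ 0 ≤ R ∧ R ≤ 4 * E ∧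
      |E - dispersionConst (n + 1) * θ ^ (2 * n + 4)| ≤ K * θ ^ (2 * n + 6) ∧
      |topDeriv (n + 1) A ^ 2 + topDeriv (n + 1) B ^ 2 - θ ^ (2 * n + 2)| ≤ K * θ ^ (2 * n + 4) ∧
      ∀ w : ℝ[X], w.natDegree ≤ n + 1 → w.eval 0 = 0 → w.eval 1 = 0 →
        ∀ Y : ℝ[X], Y = A ∨ Y = B → ∃ δ : ℝ,
          polyInner Y.derivative w.derivative = θ ^ 2 * (polyInner Y w + δ) ∧
          δ ^ 2 ≤ 4 * E * polyInner w w := by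
  obtain ⟨L, hLm, hLd, hL, hLN⟩ := exists_monic_orthogonal (n + 1)
  obtain ⟨L', hLm', hLd', hL', -⟩ := exists_monic_orthogonal n
  set N : ℝ := polyInner L L with hN
  set N' : ℝ := polyInner L' L' with hN'
  have hN0 : 0 ≤ N := polyInner_self_nonneg L
  have hN'0 : 0 < N' := lt_of_le_of_ne (polyInner_self_nonneg L') fun h0 =>
    hLm'.ne_zero (eq_zero_of_polyInner_self_eq_zero h0.symm)
  set k₁ : ℝ := 9 * (n.factorial : ℝ) ^ 2 / N' with hk₁
  have hk₁0 : 0 ≤ k₁ := by positivity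
  set K₁ : ℝ := k₁ + 1 with hK₁
  set l : ℝ := L.coeff n with hl
  refine ⟨(6 * (N + 1) + 18) + (2 * n.factorial ^ 2 * l ^ 2 + 2 * k₁ + 2 * K₁ + K₁ ^ 2),
    by positivity, fun θ hθ hθ1 => ?_⟩
  -- This phase separates the two leading effects. In g the coefficient of degree n + 1 is
  -- θ^(n+2)/(n+1)! and those of degree n and n + 2 vanish; in g' the coefficient of degree n is
  -- −θ^(n+1)/n! and that of degree n + 1 vanishes. So A carries the dispersion coefficient, with a
  -- remainder of order n + 4, and B carries the top derivative.
  set u : ℂ := (-Complex.I) ^ (n + 2) with hu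
  have hpow : ∀ m : ℕ, u * (Complex.I * θ) ^ (m + (n + 2)) = Complex.I ^ m * (θ ^ (m + (n + 2)) : ℝ) := by
    intro m
    rw [hu, mul_pow, pow_add Complex.I, Complex.ofReal_pow]
    have : (-Complex.I) ^ (n + 2) * Complex.I ^ (n + 2) = 1 := by
      rw [← mul_pow]; simp
    linear_combination (Complex.I ^ m * (θ : ℂ) ^ (m + (n + 2))) * this
  have hpow' : u * (Complex.I * θ) ^ (n + 1) = -Complex.I * (θ ^ (n + 1) : ℝ) := by
    rw [hu, mul_pow, Complex.ofReal_pow, pow_succ (-Complex.I) (n + 1)]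
    have : (-Complex.I) ^ (n + 1) * Complex.I ^ (n + 1) = 1 := by
      rw [← mul_pow]; simp
    linear_combination (-Complex.I * (θ : ℂ) ^ (n + 1)) * this
  have hun : ‖u‖ = 1 := by simp [hu]
  have hus : Complex.normSq u = 1 := by rw [Complex.normSq_eq_norm_sq, hun]; norm_num
  set f : ℝ → ℝ := wave θ u with hf
  set f' : ℝ → ℝ := wave θ (-Complex.I * u) with hf'
  set g : ℝ → ℝ := wave θ (Complex.I * θ * u) with hg
  set g' : ℝ → ℝ := wave θ (Complex.I * θ * (-Complex.I * u)) with hg'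
  have hfd : ∀ x, HasDerivAt f (g x) x := hasDerivAt_wave θ u
  have hgd : ∀ x, HasDerivAt g (-θ ^ 2 * f x) x := hasDerivAt_wave_deriv θ u
  have hfd' : ∀ x, HasDerivAt f' (g' x) x := hasDerivAt_wave θ (-Complex.I * u)
  have hgd' : ∀ x, HasDerivAt g' (-θ ^ 2 * f' x) x := hasDerivAt_wave_deriv θ (-Complex.I * u)
  have hgc : Continuous g := continuous_wave _ _
  have hgc' : Continuous g' := continuous_wave _ _
  have hfc : Continuous f := continuous_wave _ _
  have hfc' : Continuous f' := continuous_wave _ _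
  obtain ⟨A, hA⟩ := exists_isProjection (Nat.le_add_left 1 n) hfd hgc
  obtain ⟨B, hB⟩ := exists_isProjection (Nat.le_add_left 1 n) hfd' hgc'
  set EA : ℝ := l2 (fun x => g x - A.derivative.eval x) (fun x => g x - A.derivative.eval x) with hEA
  set EB : ℝ := l2 (fun x => g' x - B.derivative.eval x) (fun x => g' x - B.derivative.eval x)
    with hEB
  set RA : ℝ := l2 (fun x => f x - A.eval x) (fun x => f x - A.eval x) with hRA
  set RB : ℝ := l2 (fun x => f' x - B.eval x) (fun x => f' x - B.eval x) with hRB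
  have hEA0 : 0 ≤ EA := l2_self_nonneg _
  have hEB0 : 0 ≤ EB := l2_self_nonneg _
  have hRA0 : 0 ≤ RA := l2_self_nonneg _
  have hRB0 : 0 ≤ RB := l2_self_nonneg _
  have hRA1 : RA ≤ 4 * EA := hA.l2_error_le hfd hgc
  have hRB1 : RB ≤ 4 * EB := hB.l2_error_le hfd' hgc'
  have hff : l2 f f + l2 f' f' = 1 := by rw [hf, hf', l2_wave_add, hus]
  have hgg : l2 g g + l2 g' g' = θ ^ 2 := by
    have := l2_wave_add θ (Complex.I * θ * u)
    rw [map_mul, map_mul, hus, Complex.normSq_I, Complex.normSq_ofReal,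
      show -Complex.I * (Complex.I * θ * u) = Complex.I * θ * (-Complex.I * u) by ring] at this
    rw [hg, hg', this]
    ring
  have hθp : ∀ {a b : ℕ}, b ≤ a → θ ^ a ≤ θ ^ b := fun hab =>
    pow_le_pow_of_le_one hθ.le hθ1 hab
  have hg'e : Complex.I * θ * (-Complex.I * u) = θ * u := by
    linear_combination (-(θ : ℂ) * u) * Complex.I_sq
  have hTA : ∀ x ∈ Set.Icc (0 : ℝ) 1,
      |g x - (waveTaylor θ (Complex.I * θ * u) (n + 2)).eval x| ≤ 3 * θ ^ (n + 4) := by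
    intro x hx
    have h1 := abs_wave_sub_waveTaylor_le hθ hθ1 (Complex.I * θ * u) (n + 2 + 1) hx
    rw [waveTaylor_succ_of_eq_zero] at h1
    · refine h1.trans (le_of_eq ?_)
      rw [norm_mul, norm_mul, hun, Complex.norm_I, Complex.norm_real, Real.norm_of_nonneg hθ.le]
      ring
    · have := hpow 1
      rw [show Complex.I * θ * u * (Complex.I * θ) ^ (n + 2) = u * (Complex.I * θ) ^ (1 + (n + 2)) by
        ring, this, pow_one, Complex.re_mul_ofReal, Complex.I_re, zero_mul]
  have hTB : ∀ x ∈ Set.Icc (0 : ℝ) 1,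
      |g' x - (waveTaylor θ (θ * u) (n + 1)).eval x| ≤ 3 * θ ^ (n + 3) := by
    intro x hx
    rw [hg', hg'e]
    have h1 := abs_wave_sub_waveTaylor_le hθ hθ1 (θ * u) (n + 1 + 1) hx
    rw [waveTaylor_succ_of_eq_zero] at h1
    · refine h1.trans (le_of_eq ?_)
      rw [norm_mul, hun, Complex.norm_real, Real.norm_of_nonneg hθ.le]
      ring
    · have : (θ * u * (Complex.I * θ) ^ (n + 1) : ℂ) = -Complex.I * ((θ * θ ^ (n + 1) : ℝ) : ℂ) := by
        rw [mul_assoc, hpow']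
        push_cast
        ring
      rw [this, Complex.re_mul_ofReal]
      simp
  have cA1 : (waveTaylor θ (Complex.I * θ * u) (n + 2)).coeff (n + 1) =
      θ ^ (n + 2) / (n + 1).factorial := by
    rw [coeff_waveTaylor, if_pos (by omega)]
    have := hpow 0
    rw [show Complex.I * θ * u * (Complex.I * θ) ^ (n + 1) = u * (Complex.I * θ) ^ (0 + (n + 2)) by
      ring, this, pow_zero, one_mul, Complex.ofReal_re, zero_add]
  have cA0 : (waveTaylor θ (Complex.I * θ * u) (n + 2)).coeff n = 0 := by
    rw [coeff_waveTaylor, if_pos (by omega), show Complex.I * θ * u * (Complex.I * θ) ^ n =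
      u * (Complex.I * θ) ^ (n + 1) by ring, hpow', Complex.re_mul_ofReal]
    simp
  have cB1 : (waveTaylor θ (θ * u) (n + 1)).coeff (n + 1) = 0 := by
    rw [coeff_waveTaylor, if_neg (by omega)]
  have cB0 : (waveTaylor θ (θ * u) (n + 1)).coeff n = -θ ^ (n + 1) / n.factorial := by
    rw [coeff_waveTaylor, if_pos (by omega)]
    have : (θ * u * (Complex.I * θ) ^ n : ℂ) = ((-θ ^ (n + 1) : ℝ) : ℂ) := by
      have h2 : Complex.I * (θ * u * (Complex.I * θ) ^ n) = -Complex.I * (θ ^ (n + 1) : ℝ) := by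
        rw [← hpow']; ring
      refine mul_left_cancel₀ Complex.I_ne_zero (h2.trans ?_)
      push_cast
      ring
    rw [this, Complex.ofReal_re]
  obtain ⟨hA1, hA2⟩ := hA.compare hgc hLm hLd hL (natDegree_waveTaylor_le _ _ _) cA1 hTA
  obtain ⟨hB1, hB2⟩ := hB.compare hgc' hLm hLd hL
    ((natDegree_waveTaylor_le θ (θ * u) n).trans (Nat.le_succ n)) cB1 hTB
  rw [← hEA, ← hN] at hA1
  rw [← hEB, ← hN] at hB1
  set a : ℝ := θ ^ (n + 2) / (n + 1).factorial with ha
  have ha0 : 0 ≤ a := by positivity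
  have ha1 : a ≤ θ ^ (n + 2) := by
    rw [ha, div_le_iff₀ (by positivity)]
    exact le_mul_of_one_le_right (by positivity) (by exact_mod_cast Nat.factorial_pos _)
  have haN : a ^ 2 * N = dispersionConst (n + 1) * θ ^ (2 * n + 4) := by
    rw [ha, hLN, dispersionConst]
    have : ((n + 1).factorial : ℝ) ≠ 0 := by positivity
    have : ((2 * (n + 1)).factorial : ℝ) ≠ 0 := by positivity
    field_simp
    ring
  have hEA1 : |EA - dispersionConst (n + 1) * θ ^ (2 * n + 4)| ≤
      (6 * (N + 1) + 9) * θ ^ (2 * n + 6) := by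
    rw [← haN]
    refine hA1.trans ?_
    rw [abs_of_nonneg ha0]
    have e1 : 2 * a * (N + 1) * (3 * θ ^ (n + 4)) ≤ 2 * θ ^ (n + 2) * (N + 1) * (3 * θ ^ (n + 4)) := by
      gcongr
    have e2 : 2 * θ ^ (n + 2) * (N + 1) * (3 * θ ^ (n + 4)) = 6 * (N + 1) * θ ^ (2 * n + 6) := by ring
    have e3 : (3 * θ ^ (n + 4)) ^ 2 = 9 * θ ^ (2 * n + 8) := by ring
    have e4 : θ ^ (2 * n + 8) ≤ θ ^ (2 * n + 6) := hθp (by omega)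
    linarith
  have hEB1 : EB ≤ 9 * θ ^ (2 * n + 6) := by
    have e : |EB - 0 ^ 2 * N| = EB := by
      rw [zero_pow two_ne_zero, zero_mul, sub_zero, abs_of_nonneg hEB0]
    rw [e, abs_zero] at hB1
    refine hB1.trans (le_of_eq ?_)
    ring
  have hLc : L.coeff (n + 1) = 1 := by
    have := hLm.coeff_natDegree
    rwa [hLd] at this
  have hdeg : ∀ {X T : ℝ[X]} {b : ℝ}, X.natDegree ≤ n + 1 → T.natDegree ≤ n + 1 → T.coeff (n + 1) = b →
      (X.derivative - (T - b • L)).natDegree ≤ n := by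
    intro X T b hX hT hb
    have h1 : (T - b • L).degree < (n + 1 : ℕ) := degree_sub_lt_of_coeff_eq hT
      ((Polynomial.natDegree_smul_le _ _).trans hLd.le)
      (by rw [Polynomial.coeff_smul, hb, hLc, smul_eq_mul, mul_one])
    refine Polynomial.natDegree_le_iff_coeff_eq_zero.2 fun m hm => ?_
    rw [Polynomial.coeff_sub, Polynomial.coeff_eq_zero_of_degree_lt
      ((degree_derivative_lt hX).trans_le (by exact_mod_cast hm)),
      Polynomial.coeff_eq_zero_of_degree_lt (h1.trans_le (by exact_mod_cast hm)), sub_zero]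
  -- The comparison polynomials have degree at most n, so their L² bounds control the coefficient of
  -- degree n of A' and B', hence the top derivatives.
  have hzA := sq_coeff_mul_le hLm' hLd' hL'
    (hdeg hA.natDegree_le (natDegree_waveTaylor_le θ (Complex.I * θ * u) (n + 1)) cA1)
  have hzB := sq_coeff_mul_le hLm' hLd' hL' (hdeg hB.natDegree_le
    ((natDegree_waveTaylor_le θ (θ * u) n).trans (Nat.le_succ n)) cB1)
  replace hzA := hzA.trans hA2
  replace hzB := hzB.trans hB2
  rw [Polynomial.coeff_sub, Polynomial.coeff_sub, Polynomial.coeff_smul, cA0, smul_eq_mul, ← hl,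
    zero_sub, sub_neg_eq_add] at hzA
  rw [Polynomial.coeff_sub, Polynomial.coeff_sub, Polynomial.coeff_smul, cB0, zero_smul,
    sub_zero, neg_div, sub_neg_eq_add] at hzB
  have hn0 : (n.factorial : ℝ) ≠ 0 := by positivity
  have htA := topDeriv_eq_coeff_derivative n A
  have htB := topDeriv_eq_coeff_derivative n B
  set α : ℝ := A.derivative.coeff n with hα
  set β : ℝ := B.derivative.coeff n with hβ
  have htA1 : topDeriv (n + 1) A ^ 2 ≤ (2 * n.factorial ^ 2 * l ^ 2 + 2 * k₁) * θ ^ (2 * n + 4) := by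
    have e0 : (n.factorial : ℝ) ^ 2 * (α + a * l) ^ 2 ≤ k₁ * θ ^ (2 * n + 8) := by
      rw [hk₁, div_mul_eq_mul_div (9 * (n.factorial : ℝ) ^ 2) N', le_div_iff₀ hN'0]
      calc _ = (n.factorial : ℝ) ^ 2 * ((α + a * l) ^ 2 * N') := by ring
        _ ≤ (n.factorial : ℝ) ^ 2 * (3 * θ ^ (n + 4)) ^ 2 := by gcongr
        _ = _ := by ring
    have e1 : k₁ * θ ^ (2 * n + 8) ≤ k₁ * θ ^ (2 * n + 4) :=
      mul_le_mul_of_nonneg_left (hθp (by omega)) hk₁0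
    have e2 : a ^ 2 ≤ θ ^ (2 * n + 4) := by
      calc a ^ 2 ≤ (θ ^ (n + 2)) ^ 2 := pow_le_pow_left₀ ha0 ha1 2
        _ = _ := by ring
    have e3 : (n.factorial : ℝ) ^ 2 * l ^ 2 * a ^ 2 ≤ (n.factorial : ℝ) ^ 2 * l ^ 2 * θ ^ (2 * n + 4) :=
      mul_le_mul_of_nonneg_left e2 (by positivity)
    have e4 : 0 ≤ (n.factorial : ℝ) ^ 2 * (α + 2 * (a * l)) ^ 2 := by positivity
    rw [htA]
    linarith
  have htB1 : |topDeriv (n + 1) B ^ 2 - θ ^ (2 * n + 2)| ≤ (2 * K₁ + K₁ ^ 2) * θ ^ (2 * n + 4) := by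
    set ζ : ℝ := n.factorial * (β + θ ^ (n + 1) / n.factorial) with hζ
    have e0 : ζ ^ 2 ≤ (K₁ * θ ^ (n + 3)) ^ 2 := by
      have e0' : ζ ^ 2 ≤ k₁ * θ ^ (2 * n + 6) := by
        rw [hk₁, div_mul_eq_mul_div (9 * (n.factorial : ℝ) ^ 2) N', le_div_iff₀ hN'0]
        calc _ = (n.factorial : ℝ) ^ 2 * ((β + θ ^ (n + 1) / n.factorial) ^ 2 * N') := by
              rw [hζ]; ring
          _ ≤ (n.factorial : ℝ) ^ 2 * (3 * θ ^ (n + 3)) ^ 2 := by gcongr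
          _ = _ := by ring
      refine e0'.trans ?_
      rw [mul_pow, ← pow_mul, show (n + 3) * 2 = 2 * n + 6 by ring]
      have : k₁ ≤ K₁ ^ 2 := by rw [hK₁]; linarith [sq_nonneg k₁]
      gcongr
    have e1 : |ζ| ≤ K₁ * θ ^ (n + 3) := abs_le_of_sq_le_sq e0 (by positivity)
    have e2 : topDeriv (n + 1) B = ζ - θ ^ (n + 1) := by
      rw [htB, hζ]
      field_simp
      ring
    have e3 : topDeriv (n + 1) B ^ 2 - θ ^ (2 * n + 2) = -(2 * θ ^ (n + 1)) * ζ + ζ ^ 2 := by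
      rw [e2]; ring
    rw [e3]
    refine (abs_add_le _ _).trans ?_
    rw [abs_mul, abs_neg, abs_of_nonneg (by positivity : 0 ≤ 2 * θ ^ (n + 1)),
      abs_of_nonneg (sq_nonneg ζ)]
    have e4 : 2 * θ ^ (n + 1) * |ζ| ≤ 2 * θ ^ (n + 1) * (K₁ * θ ^ (n + 3)) := by gcongr
    have e5 : 2 * θ ^ (n + 1) * (K₁ * θ ^ (n + 3)) = 2 * K₁ * θ ^ (2 * n + 4) := by ring
    have e6 : (K₁ * θ ^ (n + 3)) ^ 2 = K₁ ^ 2 * θ ^ (2 * n + 6) := by ring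
    have e7 : K₁ ^ 2 * θ ^ (2 * n + 6) ≤ K₁ ^ 2 * θ ^ (2 * n + 4) :=
      mul_le_mul_of_nonneg_left (hθp (by omega)) (sq_nonneg _)
    linarith
  have hK1 : 0 ≤ 2 * K₁ + K₁ ^ 2 := by positivity
  refine ⟨A, B, EA + EB, RA + RB, hA.natDegree_le, hB.natDegree_le, ⟨?_, ?_⟩, ?_, ?_, ?_,
    by positivity, by linarith, ?_, ?_, ?_⟩
  · rw [hA.eval_one, hA.eval_zero, hB.eval_zero, hf, hf', wave_one]
  · rw [hB.eval_one, hA.eval_zero, hB.eval_zero, hf, hf', wave_neg_I_mul_one]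
  · rw [hA.eval_zero, hB.eval_zero, hf, hf', wave_zero_sq_add, hus]
  · rw [hA.polyInner_derivative hgc, hB.polyInner_derivative hgc', ← hgg]
    ring
  · rw [mul_add, hA.polyInner_self hfd hgd, hB.polyInner_self hfd' hgd']
    linear_combination θ ^ 2 * hff
  · have hp0 : 0 < θ ^ (2 * n + 6) := by positivity
    rw [show EA + EB - dispersionConst (n + 1) * θ ^ (2 * n + 4) =
      (EA - dispersionConst (n + 1) * θ ^ (2 * n + 4)) + EB by ring]
    refine (abs_add_le _ _).trans ?_
    rw [abs_of_nonneg hEB0]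
    have : 0 ≤ (2 * n.factorial ^ 2 * l ^ 2 + 2 * k₁ + 2 * K₁ + K₁ ^ 2) * θ ^ (2 * n + 6) := by
      positivity
    linarith
  · rw [add_sub_assoc]
    refine (abs_add_le _ _).trans ?_
    rw [abs_of_nonneg (sq_nonneg (topDeriv (n + 1) A))]
    have : 0 ≤ (6 * (N + 1) + 18) * θ ^ (2 * n + 4) := by positivity
    linarith
  · intro w hw hw0 hw1 Y hY
    have hww : 0 ≤ polyInner w w := polyInner_self_nonneg w
    rcases hY with rfl | rfl
    · refine ⟨_, hA.polyInner_bubble hfd hgd hw hw0 hw1, ?_⟩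
      refine (l2_cauchySchwarz (by fun_prop) (by fun_prop)).trans ?_
      rw [← polyInner_eq_l2]
      exact mul_le_mul_of_nonneg_right (by linarith) hww
    · refine ⟨_, hB.polyInner_bubble hfd' hgd' hw hw0 hw1, ?_⟩
      refine (l2_cauchySchwarz (by fun_prop) (by fun_prop)).trans ?_
      rw [← polyInner_eq_l2]
      exact mul_le_mul_of_nonneg_right (by linarith) hww

/-! ### Definiteness from a quasimode and coercivity on bubbles -/

theorem polyInner_derivative_pos {w : ℝ[X]} (h0 : w.eval 0 = 0) (hw : w ≠ 0) :
    0 < polyInner w.derivative w.derivative := by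
  refine lt_of_le_of_ne (polyInner_self_nonneg _) fun h => hw ?_
  have h1 := Polynomial.derivative_eq_zero.1
    (eq_zero_of_polyInner_self_eq_zero h.symm)
  rw [Polynomial.eq_C_of_natDegree_eq_zero h1] at h0 ⊢
  simpa using h0

/-- In `elementForm_pos` the four cross terms cost 16D(a² + b²) in all and N/4 for each bubble, half
of its coercivity N/2. -/
theorem abs_two_mul_mul_le {a F D N : ℝ} (hD : 0 ≤ D) (hN : 0 ≤ N) (h : F ^ 2 ≤ D * N) :
    |2 * a * F| ≤ 8 * a ^ 2 * D + N / 8 := by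
  refine abs_le_of_sq_le_sq ?_ (by positivity)
  have h1 : a ^ 2 * F ^ 2 ≤ a ^ 2 * (D * N) := mul_le_mul_of_nonneg_left h (sq_nonneg a)
  have h2 : 0 ≤ (8 * a ^ 2 * D - N / 8) ^ 2 := sq_nonneg _
  linarith

/-- The Bloch form is positive definite if it is large at a quasimode, coercive on the bubbles, and
the residual of the quasimode is small. -/
theorem elementForm_pos {p : ℕ} {t g θ D : ℝ} {A B : ℝ[X]} (hA : A.natDegree ≤ p)
    (hB : B.natDegree ≤ p) (hAB : BlochPair θ A B) (h1 : A.eval 0 ^ 2 + B.eval 0 ^ 2 = 1)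
    (hD : 0 ≤ D) (hβ : 16 * D < elementForm p t g A A + elementForm p t g B B)
    (hres : ∀ w : ℝ[X], w.natDegree ≤ p → w.eval 0 = 0 → w.eval 1 = 0 → ∀ Y : ℝ[X], Y = A ∨ Y = B →
      elementForm p t g Y w ^ 2 ≤ D * polyInner w.derivative w.derivative)
    (hcoer : ∀ w : ℝ[X], w.natDegree ≤ p → w.eval 0 = 0 →
      polyInner w.derivative w.derivative / 2 ≤ elementForm p t g w w)
    {P Q : ℝ[X]} (hP : P.natDegree ≤ p) (hQ : Q.natDegree ≤ p) (hPQ : BlochPair θ P Q)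
    (hne : P ≠ 0 ∨ Q ≠ 0) : 0 < elementForm p t g P P + elementForm p t g Q Q := by
  -- Here a + ib = (P + iQ)(0) times the conjugate of (A + iB)(0), which has modulus one.
  -- Subtracting (a + ib)(A + iB) from P + iQ leaves w₁ + iw₂, which vanishes at 0 and, by the Bloch
  -- condition, at 1.
  set a : ℝ := P.eval 0 * A.eval 0 + Q.eval 0 * B.eval 0 with ha
  set b : ℝ := Q.eval 0 * A.eval 0 - P.eval 0 * B.eval 0 with hb
  have hP0 : P.eval 0 = a * A.eval 0 - b * B.eval 0 := by
    rw [ha, hb]; linear_combination -P.eval 0 * h1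
  have hQ0 : Q.eval 0 = a * B.eval 0 + b * A.eval 0 := by
    rw [ha, hb]; linear_combination -Q.eval 0 * h1
  set w₁ : ℝ[X] := P - (a • A - b • B) with hw₁
  set w₂ : ℝ[X] := Q - (a • B + b • A) with hw₂
  have hd : ∀ c : ℝ, ∀ X : ℝ[X], X.natDegree ≤ p → (c • X).natDegree ≤ p := fun c X hX =>
    (Polynomial.natDegree_smul_le c X).trans hX
  have d₁ : w₁.natDegree ≤ p := Polynomial.natDegree_sub_le_of_le hP
    (Polynomial.natDegree_sub_le_of_le (hd a A hA) (hd b B hB)) |>.trans (by simp)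
  have d₂ : w₂.natDegree ≤ p := Polynomial.natDegree_sub_le_of_le hQ
    (Polynomial.natDegree_add_le_of_degree_le (hd a B hB) (hd b A hA)) |>.trans (by simp)
  have z₁ : w₁.eval 0 = 0 := by
    simp only [hw₁, Polynomial.eval_sub, Polynomial.eval_smul, smul_eq_mul]; linarith
  have z₂ : w₂.eval 0 = 0 := by
    simp only [hw₂, Polynomial.eval_sub, Polynomial.eval_add, Polynomial.eval_smul, smul_eq_mul]
    linarith
  have o₁ : w₁.eval 1 = 0 := by
    simp only [hw₁, Polynomial.eval_sub, Polynomial.eval_smul, smul_eq_mul, hPQ.1, hAB.1, hAB.2]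
    linear_combination Real.cos θ * hP0 - Real.sin θ * hQ0
  have o₂ : w₂.eval 1 = 0 := by
    simp only [hw₂, Polynomial.eval_sub, Polynomial.eval_add, Polynomial.eval_smul, smul_eq_mul,
      hPQ.2, hAB.1, hAB.2]
    linear_combination Real.sin θ * hP0 + Real.cos θ * hQ0
  have hPe : P = a • A - b • B + w₁ := by rw [hw₁]; ring
  have hQe : Q = a • B + b • A + w₂ := by rw [hw₂]; ring
  set β : ℝ := elementForm p t g A A + elementForm p t g B B with hβdef
  have hexp : elementForm p t g P P + elementForm p t g Q Q = (a ^ 2 + b ^ 2) * β +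
      2 * a * elementForm p t g A w₁ + 2 * -b * elementForm p t g B w₁ +
      2 * a * elementForm p t g B w₂ + 2 * b * elementForm p t g A w₂ +
      elementForm p t g w₁ w₁ + elementForm p t g w₂ w₂ := by
    rw [hPe, hQe]
    simp only [map_add, map_sub, LinearMap.add_apply, LinearMap.sub_apply, map_smul,
      LinearMap.smul_apply, smul_eq_mul, elementForm_comm p t g w₁ A, elementForm_comm p t g w₁ B,
      elementForm_comm p t g w₂ A, elementForm_comm p t g w₂ B, elementForm_comm p t g B A, hβdef]
    ring
  have N₁ := polyInner_self_nonneg w₁.derivative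
  have N₂ := polyInner_self_nonneg w₂.derivative
  have b₁ := (abs_le.1 (abs_two_mul_mul_le (a := a) hD N₁ (hres w₁ d₁ z₁ o₁ A (Or.inl rfl)))).1
  have b₂ := (abs_le.1 (abs_two_mul_mul_le (a := -b) hD N₁ (hres w₁ d₁ z₁ o₁ B (Or.inr rfl)))).1
  have b₃ := (abs_le.1 (abs_two_mul_mul_le (a := a) hD N₂ (hres w₂ d₂ z₂ o₂ B (Or.inr rfl)))).1
  have b₄ := (abs_le.1 (abs_two_mul_mul_le (a := b) hD N₂ (hres w₂ d₂ z₂ o₂ A (Or.inl rfl)))).1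
  rw [neg_sq] at b₂
  have c₁ := hcoer w₁ d₁ z₁
  have c₂ := hcoer w₂ d₂ z₂
  have hlow : (a ^ 2 + b ^ 2) * (β - 16 * D) + polyInner w₁.derivative w₁.derivative / 4 +
      polyInner w₂.derivative w₂.derivative / 4 ≤
      elementForm p t g P P + elementForm p t g Q Q := by
    rw [hexp]; linarith
  refine lt_of_lt_of_le ?_ hlow
  have hβ' : 0 < β - 16 * D := by linarith
  have hab : 0 ≤ a ^ 2 + b ^ 2 := by positivity
  rcases hab.lt_or_eq with hab | hab
  · have := mul_pos hab hβ'
    linarith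
  · have ha0 : a = 0 := (pow_eq_zero_iff two_ne_zero).1 (by linarith [sq_nonneg a, sq_nonneg b])
    have hb0 : b = 0 := (pow_eq_zero_iff two_ne_zero).1 (by linarith [sq_nonneg a, sq_nonneg b])
    rw [ha0, hb0, zero_smul, zero_smul, sub_zero, zero_add] at hPe
    rw [ha0, hb0, zero_smul, zero_smul, add_zero, zero_add] at hQe
    rw [← hab, zero_mul]
    rcases hne with hne | hne
    · have := polyInner_derivative_pos z₁ (hPe ▸ hne)
      linarith
    · have := polyInner_derivative_pos z₂ (hQe ▸ hne)
      linarith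

theorem exists_sq_topDeriv_le (n : ℕ) : ∃ K > (0 : ℝ), ∀ w : ℝ[X], w.natDegree ≤ n + 1 →
    topDeriv (n + 1) w ^ 2 ≤ K * polyInner w.derivative w.derivative := by
  obtain ⟨L, hLm, hLd, hL, -⟩ := exists_monic_orthogonal n
  have hN : 0 < polyInner L L := lt_of_le_of_ne (polyInner_self_nonneg L) fun h0 =>
    hLm.ne_zero (eq_zero_of_polyInner_self_eq_zero h0.symm)
  refine ⟨(n.factorial : ℝ) ^ 2 / polyInner L L, by positivity, fun w hw => ?_⟩
  have h1 : w.derivative.natDegree ≤ n := (Polynomial.natDegree_derivative_le w).trans (by omega)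
  have h2 := sq_coeff_mul_le hLm hLd hL h1
  rw [topDeriv_eq_coeff_derivative, div_mul_eq_mul_div, le_div_iff₀ hN, mul_pow, mul_assoc]
  exact mul_le_mul_of_nonneg_left h2 (by positivity)

theorem sq_add_add_le (x y z : ℝ) : (x + y + z) ^ 2 ≤ 3 * (x ^ 2 + y ^ 2 + z ^ 2) := by
  nlinarith [sq_nonneg (x - y), sq_nonneg (y - z), sq_nonneg (x - z)]

theorem two_sub_two_mul_cos_bounds {θ : ℝ} (hθ : 0 < θ) (hθ1 : θ ≤ 1) :
    0 ≤ 2 - 2 * Real.cos θ ∧ 2 - 2 * Real.cos θ ≤ θ ^ 2 ∧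
      |2 - 2 * Real.cos θ - θ ^ 2| ≤ θ ^ 4 := by
  have h1 := Real.cos_bound (x := θ) (by rw [abs_of_pos hθ]; exact hθ1)
  rw [abs_of_pos hθ] at h1
  have h2 := Real.one_sub_sq_div_two_le_cos (x := θ)
  have h3 := Real.cos_le_one θ
  have h4 : 0 < θ ^ 4 := by positivity
  refine ⟨by linarith, by linarith, ?_⟩
  rw [abs_le] at h1 ⊢
  constructor <;> linarith [h1.1, h1.2]

/-! ### Sign of the Bloch form near the predicted phase -/

set_option maxHeartbeats 1000000 in
/-- The sign of the Bloch form close to the expected discrete phase. -/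
theorem exists_sign_bounds (n : ℕ) (γ L : ℝ) (hL : 0 ≤ L) :
    ∃ K > (0 : ℝ), ∃ t₀ > (0 : ℝ), ∀ t θ : ℝ, 0 < t → t ≤ t₀ → t ≤ 2 * θ → θ ≤ 2 * t → θ ≤ 1 →
      |θ - t| ≤ L * t ^ (2 * n + 3) →
      (K * t ^ (2 * n + 6) ≤
          θ ^ 2 - t ^ 2 + (dispersionConst (n + 1) + γ) * θ ^ (2 * n + 4) →
        ∀ P Q : ℝ[X], P.natDegree ≤ n + 1 → Q.natDegree ≤ n + 1 → BlochPair θ P Q →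
          (P ≠ 0 ∨ Q ≠ 0) →
          0 < elementForm (n + 1) t (γ * (2 - 2 * Real.cos θ)) P P +
            elementForm (n + 1) t (γ * (2 - 2 * Real.cos θ)) Q Q) ∧
      (θ ^ 2 - t ^ 2 + (dispersionConst (n + 1) + γ) * θ ^ (2 * n + 4) ≤ -(K * t ^ (2 * n + 6)) →
        ∃ P Q : ℝ[X], P.natDegree ≤ n + 1 ∧ Q.natDegree ≤ n + 1 ∧ BlochPair θ P Q ∧
          elementForm (n + 1) t (γ * (2 - 2 * Real.cos θ)) P P +
            elementForm (n + 1) t (γ * (2 - 2 * Real.cos θ)) Q Q < 0) := by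
  obtain ⟨K₀, hK₀, hquasi⟩ := exists_quasimode n
  obtain ⟨K₄, hK₄, htop⟩ := exists_sq_topDeriv_le n
  set c : ℝ := dispersionConst (n + 1) with hc
  have hc0 : 0 ≤ c := by rw [hc, dispersionConst]; positivity
  set K₂ : ℝ := c + K₀ with hK₂
  have hK₂0 : 0 ≤ K₂ := by positivity
  set W : ℝ := 2 ^ (2 * n + 6) with hW
  have hW0 : 0 < W := by positivity
  set K₁ : ℝ := K₀ * W + 24 * L * K₂ + 4 * K₂ * W + |γ| * (K₀ + 1) * W with hK₁
  have hK₁0 : 0 < K₁ := by positivity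
  set K₃ : ℝ := 3 * (9 * L ^ 2 * ((1 + 4 * K₂) * 4) + 16 * K₂ * W + γ ^ 2 * (1 + K₀) * K₄ * W)
    with hK₃
  have hK₃0 : 0 ≤ K₃ := by positivity
  -- `K₁` bounds the error of the form at the quasimode, 16`K₃` pays for the cross terms, and 1
  -- makes both signs strict. The bound on t makes the mass and penalty terms of a bubble at most a
  -- quarter of its energy each, leaving the coercivity constant ½.
  refine ⟨K₁ + 16 * K₃ + 1, by positivity, 1 / (4 * (1 + |γ| * K₄)), by positivity, ?_⟩
  intro t θ ht ht0 hθ1 hθ2 hθle hθt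
  have hθ : 0 < θ := by linarith
  set x : ℝ := |γ| * K₄ with hx
  have hx0 : 0 ≤ x := by positivity
  have ht0' : t * (4 * (1 + x)) ≤ 1 := by
    rwa [le_div_iff₀ (by positivity)] at ht0
  have htx0 : 0 ≤ t * x := mul_nonneg ht.le hx0
  have ht4 : t ≤ 1 / 4 := by linarith
  have ht1 : t ≤ 1 := by linarith
  have htx : 4 * x * t ^ 2 ≤ 1 / 4 := by
    have e1 : x * t ≤ 1 / 4 := by linarith
    have e2 : (x * t) * t ≤ (1 / 4) * (1 / 4) := mul_le_mul e1 ht4 ht.le (by norm_num)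
    linarith
  have htp : ∀ {a b : ℕ}, b ≤ a → t ^ a ≤ t ^ b := fun hab => pow_le_pow_of_le_one ht.le ht1 hab
  have hθp : ∀ {a b : ℕ}, b ≤ a → θ ^ a ≤ θ ^ b := fun hab =>
    pow_le_pow_of_le_one hθ.le hθle hab
  set q : ℝ := t ^ (2 * n + 6) with hq
  have hq0 : 0 < q := by positivity
  have hθq : θ ^ (2 * n + 6) ≤ W * q := by
    calc _ ≤ (2 * t) ^ (2 * n + 6) := pow_le_pow_left₀ hθ.le hθ2 _
      _ = _ := by rw [mul_pow]
  have hθq' : t ^ 2 * θ ^ (2 * n + 4) ≤ W * q := by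
    calc _ ≤ t ^ 2 * (2 * t) ^ (2 * n + 4) := by gcongr
      _ = 2 ^ (2 * n + 4) * q := by rw [mul_pow, hq]; ring
      _ ≤ W * q := by
        refine mul_le_mul_of_nonneg_right ?_ hq0.le
        exact pow_le_pow_right₀ one_le_two (by omega)
  have hsq : |θ ^ 2 - t ^ 2| ≤ 3 * L * t ^ (2 * n + 4) := by
    rw [sq_sub_sq, abs_mul, abs_of_pos (by positivity : 0 < θ + t)]
    calc (θ + t) * |θ - t| ≤ (3 * t) * (L * t ^ (2 * n + 3)) := by
          refine mul_le_mul (by linarith) hθt (abs_nonneg _) (by positivity)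
      _ = _ := by ring
  obtain ⟨A, B, E, R, hA, hB, hAB, h1, hE, hR, hR0, hR1, hEc, hT, hbub⟩ := hquasi θ hθ hθle
  obtain ⟨hg0, hg1, hg2⟩ := two_sub_two_mul_cos_bounds hθ hθle
  set ω : ℝ := 2 - 2 * Real.cos θ with hω
  set T : ℝ := topDeriv (n + 1) A ^ 2 + topDeriv (n + 1) B ^ 2 with hTdef
  have hE1 : E ≤ K₂ * θ ^ (2 * n + 4) := by
    have e1 := (abs_le.1 hEc).2
    have e2 : K₀ * θ ^ (2 * n + 6) ≤ K₀ * θ ^ (2 * n + 4) :=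
      mul_le_mul_of_nonneg_left (hθp (by omega)) hK₀.le
    rw [hK₂, add_mul]
    linarith
  have hE0 : 0 ≤ E := by linarith
  have hE2 : E / θ ^ 2 ≤ 4 * K₂ * t ^ 2 := by
    rw [div_le_iff₀ (by positivity)]
    calc E ≤ K₂ * θ ^ (2 * n + 4) := hE1
      _ ≤ K₂ * θ ^ 4 := mul_le_mul_of_nonneg_left (hθp (by omega)) hK₂0
      _ = K₂ * θ ^ 2 * θ ^ 2 := by ring
      _ ≤ K₂ * (2 * t) ^ 2 * θ ^ 2 := by gcongr
      _ = _ := by ring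
  have hEK : E ≤ K₂ := hE1.trans (mul_le_of_le_one_right hK₂0 (pow_le_one₀ hθ.le hθle))
  have hR2 : R ≤ 4 * K₂ * θ ^ (2 * n + 4) := by linarith
  have hT1 : T ≤ (1 + K₀) * θ ^ (2 * n + 2) := by
    have e1 := (abs_le.1 hT).2
    have e2 : K₀ * θ ^ (2 * n + 4) ≤ K₀ * θ ^ (2 * n + 2) :=
      mul_le_mul_of_nonneg_left (hθp (by omega)) hK₀.le
    linarith
  set β : ℝ := elementForm (n + 1) t (γ * ω) A A + elementForm (n + 1) t (γ * ω) B B with hβ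
  -- The stiffness term contributes −E and the mass term 2t²E/θ², so the net effect is +E up to a
  -- multiple of t² − θ².
  have hβe : β - (θ ^ 2 - t ^ 2 + (c + γ) * θ ^ (2 * n + 4)) =
      (E - c * θ ^ (2 * n + 4)) + 2 * (t ^ 2 - θ ^ 2) * (E / θ ^ 2) + -(t ^ 2 * R) +
        γ * (ω * (T - θ ^ (2 * n + 2)) + (ω - θ ^ 2) * θ ^ (2 * n + 2)) := by
    have hS : polyInner A A + polyInner B B = 1 - 2 * (E / θ ^ 2) + R := by
      have : θ ^ 2 ≠ 0 := by positivity
      field_simp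
      linear_combination hR
    rw [hβ, elementForm_apply, elementForm_apply, hTdef]
    have hE' : E / θ ^ 2 * θ ^ 2 = E := div_mul_cancel₀ _ (by positivity)
    linear_combination hE - t ^ 2 * hS + 2 * hE'
  have hβ1 : |β - (θ ^ 2 - t ^ 2 + (c + γ) * θ ^ (2 * n + 4))| ≤ K₁ * q := by
    rw [hβe]
    have m1 : |E - c * θ ^ (2 * n + 4)| ≤ K₀ * (W * q) :=
      hEc.trans (mul_le_mul_of_nonneg_left hθq hK₀.le)
    have m2 : |2 * (t ^ 2 - θ ^ 2) * (E / θ ^ 2)| ≤ 24 * L * K₂ * q := by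
      rw [abs_mul, abs_mul, abs_two, abs_sub_comm, abs_of_nonneg (by positivity : 0 ≤ E / θ ^ 2)]
      calc _ ≤ 2 * (3 * L * t ^ (2 * n + 4)) * (4 * K₂ * t ^ 2) := by gcongr
        _ = _ := by rw [hq]; ring
    have m3 : |-(t ^ 2 * R)| ≤ 4 * K₂ * (W * q) := by
      rw [abs_neg, abs_of_nonneg (by positivity)]
      calc t ^ 2 * R ≤ t ^ 2 * (4 * K₂ * θ ^ (2 * n + 4)) := by gcongr
        _ = 4 * K₂ * (t ^ 2 * θ ^ (2 * n + 4)) := by ring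
        _ ≤ _ := mul_le_mul_of_nonneg_left hθq' (by positivity)
    have m4 : |γ * (ω * (T - θ ^ (2 * n + 2)) + (ω - θ ^ 2) * θ ^ (2 * n + 2))| ≤
        |γ| * ((K₀ + 1) * (W * q)) := by
      rw [abs_mul]
      refine mul_le_mul_of_nonneg_left ?_ (abs_nonneg γ)
      refine (abs_add_le _ _).trans ?_
      rw [abs_mul, abs_mul, abs_of_nonneg hg0, abs_of_nonneg (by positivity : 0 ≤ θ ^ (2 * n + 2))]
      calc _ ≤ θ ^ 2 * (K₀ * θ ^ (2 * n + 4)) + θ ^ 4 * θ ^ (2 * n + 2) := by gcongr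
        _ = (K₀ + 1) * θ ^ (2 * n + 6) := by ring
        _ ≤ _ := mul_le_mul_of_nonneg_left hθq (by positivity)
    refine (abs_add_le _ _).trans ((add_le_add ((abs_add_le _ _).trans (add_le_add
      ((abs_add_le _ _).trans (add_le_add m1 m2)) m3)) m4).trans (le_of_eq ?_))
    rw [hK₁]
    ring
  obtain ⟨hβl, hβu⟩ := abs_le.1 hβ1
  have hK₃q : 0 ≤ K₃ * q := by positivity
  refine ⟨fun hpos P Q hP hQ hPQ hne => ?_, fun hneg => ⟨A, B, hA, hB, hAB, ?_⟩⟩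
  · refine elementForm_pos hA hB hAB h1 hK₃q ?_ ?_ ?_ hP hQ hPQ hne
    · linarith
    · intro w hw hw0 hw1 Y hY
      obtain ⟨δ, hδ1, hδ2⟩ := hbub w hw hw0 hw1 Y hY
      set N : ℝ := polyInner w.derivative w.derivative with hN
      have hN0 : 0 ≤ N := polyInner_self_nonneg _
      have hwN : polyInner w w ≤ 4 * N := polyInner_self_le_derivative hw0
      have hww : 0 ≤ polyInner w w := polyInner_self_nonneg _
      have hYY : polyInner Y Y ≤ 1 + 4 * K₂ := by
        have e1 : polyInner A A + polyInner B B ≤ 1 + R := by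
          have : θ ^ 2 * (polyInner A A + polyInner B B) ≤ θ ^ 2 * (1 + R) := by linarith
          exact le_of_mul_le_mul_left this (by positivity)
        have e2 := polyInner_self_nonneg A
        have e3 := polyInner_self_nonneg B
        rcases hY with rfl | rfl <;> linarith
      have hYT : topDeriv (n + 1) Y ^ 2 ≤ T := by
        rcases hY with rfl | rfl
        · exact le_add_of_nonneg_right (sq_nonneg _)
        · exact le_add_of_nonneg_left (sq_nonneg _)
      have hYw : polyInner Y w ^ 2 ≤ (1 + 4 * K₂) * (4 * N) :=
        (polyInner_cauchySchwarz Y w).trans (mul_le_mul hYY hwN hww (by positivity))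
      have hform : elementForm (n + 1) t (γ * ω) Y w = (θ ^ 2 - t ^ 2) * polyInner Y w +
          θ ^ 2 * δ + γ * ω * (topDeriv (n + 1) Y * topDeriv (n + 1) w) := by
        rw [elementForm_apply, hδ1]; ring
      rw [hform]
      refine (sq_add_add_le _ _ _).trans ?_
      -- The three squared residual terms have orders t^(4n+8), θ^(2n+8) and θ^(2n+6) times N. The
      -- penalty term is the critical one; it just matches the admissible t^(2n+6).
      have r1 : ((θ ^ 2 - t ^ 2) * polyInner Y w) ^ 2 ≤ 9 * L ^ 2 * q * ((1 + 4 * K₂) * (4 * N)) := by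
        rw [mul_pow]
        refine mul_le_mul ?_ hYw (sq_nonneg _) (by positivity)
        rw [← sq_abs]
        calc |θ ^ 2 - t ^ 2| ^ 2 ≤ (3 * L * t ^ (2 * n + 4)) ^ 2 :=
              pow_le_pow_left₀ (abs_nonneg _) hsq 2
          _ = 9 * L ^ 2 * t ^ (4 * n + 8) := by ring
          _ ≤ 9 * L ^ 2 * q := mul_le_mul_of_nonneg_left (htp (by omega)) (by positivity)
      have r2 : (θ ^ 2 * δ) ^ 2 ≤ 16 * K₂ * (W * q) * N := by
        calc (θ ^ 2 * δ) ^ 2 = θ ^ 4 * δ ^ 2 := by ring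
          _ ≤ θ ^ 4 * (4 * E * polyInner w w) := by gcongr
          _ ≤ θ ^ 4 * (4 * (K₂ * θ ^ (2 * n + 4)) * (4 * N)) := by gcongr
          _ = 16 * K₂ * θ ^ (2 * n + 8) * N := by ring
          _ ≤ 16 * K₂ * (W * q) * N := by
            have : θ ^ (2 * n + 8) ≤ W * q := (hθp (by omega)).trans hθq
            gcongr
      have r3 : (γ * ω * (topDeriv (n + 1) Y * topDeriv (n + 1) w)) ^ 2 ≤
          γ ^ 2 * (1 + K₀) * K₄ * (W * q) * N := by
        calc _ = γ ^ 2 * ω ^ 2 * (topDeriv (n + 1) Y ^ 2 * topDeriv (n + 1) w ^ 2) := by ring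
          _ ≤ γ ^ 2 * (θ ^ 2) ^ 2 * (((1 + K₀) * θ ^ (2 * n + 2)) * (K₄ * N)) := by
            have := htop w hw
            have := hYT.trans hT1
            gcongr
          _ = γ ^ 2 * (1 + K₀) * K₄ * θ ^ (2 * n + 6) * N := by ring
          _ ≤ _ := by gcongr
      calc _ ≤ 3 * (9 * L ^ 2 * q * ((1 + 4 * K₂) * (4 * N)) + 16 * K₂ * (W * q) * N +
            γ ^ 2 * (1 + K₀) * K₄ * (W * q) * N) := by gcongr
        _ = _ := by rw [hK₃]; ring
    · intro w hw hw0
      set N : ℝ := polyInner w.derivative w.derivative with hN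
      have hN0 : 0 ≤ N := polyInner_self_nonneg _
      have hwN : polyInner w w ≤ 4 * N := polyInner_self_le_derivative hw0
      have e1 : t ^ 2 * polyInner w w ≤ (1 / 4) ^ 2 * (4 * N) := by
        refine mul_le_mul (pow_le_pow_left₀ ht.le ht4 2) hwN (polyInner_self_nonneg _) (by norm_num)
      have e2 : |γ * ω * (topDeriv (n + 1) w * topDeriv (n + 1) w)| ≤ (1 / 4) * N := by
        rw [← sq, abs_mul, abs_mul, abs_of_nonneg hg0, abs_of_nonneg (sq_nonneg (topDeriv (n + 1) w))]
        calc _ ≤ |γ| * (2 * t) ^ 2 * (K₄ * N) := by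
              have := hg1.trans (pow_le_pow_left₀ hθ.le hθ2 2)
              have := htop w hw
              gcongr
          _ = (4 * x * t ^ 2) * N := by rw [hx]; ring
          _ ≤ _ := mul_le_mul_of_nonneg_right htx hN0
      rw [elementForm_apply, ← hN]
      have e3 := (abs_le.1 e2).1
      linarith
  · change β < 0
    linarith

/-! ### Bracketing the discrete wave number -/

/-- A discrete wave number with the expected phase difference. -/
theorem exists_discreteWaveNumber_near (n : ℕ) (γ : ℝ) : ∃ t₀ > (0 : ℝ), ∃ M > (0 : ℝ),
    ∀ k h : ℝ, 0 < h → 0 < k * h → k * h ≤ t₀ → ∃ θ : ℝ, 0 < θ ∧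
      IsDiscreteWaveNumber (n + 1) h k γ (θ / h) ∧
      |k * h - θ - 1 / 2 * (dispersionConst (n + 1) + γ) * (k * h) ^ (2 * n + 3)| ≤
        M * (k * h) ^ (2 * n + 5) := by
  set κ : ℝ := dispersionConst (n + 1) + γ with hκ
  set L : ℝ := |κ| / 2 + 1 with hL
  have hL0 : 0 < L := by positivity
  obtain ⟨K, hK, t₁, ht₁, hsign⟩ := exists_sign_bounds n γ L hL0.le
  set V : ℝ := |κ| * (L * (2 * n + 4) * 2 ^ (2 * n + 3)) with hV
  have hV0 : 0 ≤ V := by positivity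
  -- A shift of θ by M t^(2n+5) moves θ² − t² by 2M t^(2n+6) to leading order. This covers the
  -- threshold `K` and the expansion error `L`² + `V`.
  set M : ℝ := (K + L ^ 2 + V) / 2 with hM
  have hM0 : 0 < M := by positivity
  refine ⟨min t₁ (1 / (M + 2 * L + 2)), by positivity, M, hM0, ?_⟩
  intro k h hh ht htle
  set t : ℝ := k * h with htdef
  have ht1 : t ≤ t₁ := htle.trans (min_le_left _ _)
  have ht2 : t * (M + 2 * L + 2) ≤ 1 := by
    have := htle.trans (min_le_right _ _)
    rwa [le_div_iff₀ (by positivity)] at this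
  have htM : 0 < t * M := mul_pos ht hM0
  have htL : 0 < t * L := mul_pos ht hL0
  have ht3 : t ≤ 1 / 2 := by linarith
  have htM1 : M * t ^ 2 ≤ 1 := by
    have e1 : t * M ≤ 1 := by linarith
    have e2 : (t * M) * t ≤ 1 * 1 := mul_le_mul e1 (by linarith) ht.le zero_le_one
    linarith
  have htp : ∀ {a b : ℕ}, b ≤ a → t ^ a ≤ t ^ b := fun hab =>
    pow_le_pow_of_le_one ht.le (by linarith) hab
  have hLt : L * t ^ (2 * n + 3) ≤ t / 2 := by
    have e1 : t ^ (2 * n + 3) ≤ t ^ 2 := htp (by omega)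
    have e2 : L * t ^ (2 * n + 3) ≤ L * t ^ 2 := mul_le_mul_of_nonneg_left e1 hL0.le
    have e3 : t * L ≤ 1 / 2 := by linarith
    have e4 : (t * L) * t ≤ (1 / 2) * t := mul_le_mul_of_nonneg_right e3 ht.le
    linarith
  have hnear : ∀ μ : ℝ, |μ| ≤ M →
      |-(1 / 2) * κ * t ^ (2 * n + 3) + μ * t ^ (2 * n + 5)| ≤ L * t ^ (2 * n + 3) := by
    intro μ hμ
    refine (abs_add_le _ _).trans ?_
    have hp3 : 0 < t ^ (2 * n + 3) := by positivity
    rw [abs_mul, abs_mul, abs_mul, abs_of_pos hp3, abs_of_pos (by positivity : 0 < t ^ (2 * n + 5)),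
      abs_neg, abs_of_pos (by norm_num : (0 : ℝ) < 1 / 2)]
    calc _ ≤ 1 / 2 * |κ| * t ^ (2 * n + 3) + M * t ^ (2 * n + 5) := by gcongr
      _ = 1 / 2 * |κ| * t ^ (2 * n + 3) + (M * t ^ 2) * t ^ (2 * n + 3) := by ring
      _ ≤ 1 / 2 * |κ| * t ^ (2 * n + 3) + 1 * t ^ (2 * n + 3) := by gcongr
      _ = _ := by rw [hL]; ring
  have hdata : ∀ θ : ℝ, |θ - t| ≤ L * t ^ (2 * n + 3) → t ≤ 2 * θ ∧ θ ≤ 2 * t ∧ θ ≤ 1 := by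
    intro θ hθ
    have := abs_le.1 (hθ.trans hLt)
    refine ⟨by linarith [this.1], by linarith [this.2], by linarith [this.2]⟩
  have hexpand : ∀ μ : ℝ, |μ| ≤ M → ∀ θ : ℝ,
      θ = t + (-(1 / 2) * κ * t ^ (2 * n + 3) + μ * t ^ (2 * n + 5)) →
      |θ ^ 2 - t ^ 2 + κ * θ ^ (2 * n + 4) - 2 * μ * t ^ (2 * n + 6)| ≤
        (L ^ 2 + V) * t ^ (2 * n + 6) := by
    intro μ hμ θ hθ
    have hd : |θ - t| ≤ L * t ^ (2 * n + 3) := by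
      rw [hθ, add_sub_cancel_left]; exact hnear μ hμ
    obtain ⟨d1, d2, -⟩ := hdata θ hd
    have hθ0 : 0 < θ := by linarith
    -- Writing θ² − t² = 2t(θ − t) + (θ − t)², the shift −½κt^(2n+3) cancels κt^(2n+4) exactly.
    have e : θ ^ 2 - t ^ 2 + κ * θ ^ (2 * n + 4) - 2 * μ * t ^ (2 * n + 6) =
        (θ - t) ^ 2 + κ * (θ ^ (2 * n + 4) - t ^ (2 * n + 4)) := by
      have : θ - t = -(1 / 2) * κ * t ^ (2 * n + 3) + μ * t ^ (2 * n + 5) := by rw [hθ]; ring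
      linear_combination 2 * t * this
    have e1 : (θ - t) ^ 2 ≤ L ^ 2 * t ^ (2 * n + 6) := by
      rw [← sq_abs]
      calc |θ - t| ^ 2 ≤ (L * t ^ (2 * n + 3)) ^ 2 := pow_le_pow_left₀ (abs_nonneg _) hd 2
        _ = L ^ 2 * t ^ (4 * n + 6) := by ring
        _ ≤ L ^ 2 * t ^ (2 * n + 6) := mul_le_mul_of_nonneg_left (htp (by omega)) (by positivity)
    have e2 : |θ ^ (2 * n + 4) - t ^ (2 * n + 4)| ≤
        L * (2 * n + 4) * 2 ^ (2 * n + 3) * t ^ (2 * n + 6) := by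
      have hmax : max |θ| |t| ≤ 2 * t := by
        rw [abs_of_pos hθ0, abs_of_pos ht]
        exact max_le d2 (by linarith)
      have h1 := abs_pow_sub_pow_le θ t (2 * n + 4)
      push_cast at h1
      calc _ ≤ |θ - t| * (2 * n + 4) * max |θ| |t| ^ (2 * n + 3) := h1
        _ ≤ (L * t ^ (2 * n + 3)) * (2 * n + 4) * (2 * t) ^ (2 * n + 3) := by gcongr
        _ = L * (2 * n + 4) * 2 ^ (2 * n + 3) * t ^ (4 * n + 6) := by rw [mul_pow]; ring
        _ ≤ _ := mul_le_mul_of_nonneg_left (htp (by omega)) (by positivity)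
    rw [e]
    refine (abs_add_le _ _).trans ?_
    rw [abs_of_nonneg (sq_nonneg (θ - t)), abs_mul, add_mul]
    refine add_le_add e1 ?_
    calc _ ≤ |κ| * (L * (2 * n + 4) * 2 ^ (2 * n + 3) * t ^ (2 * n + 6)) := by gcongr
      _ = _ := by rw [hV]; ring
  have hMM : |M| ≤ M := (abs_of_pos hM0).le
  have hMM' : |-M| ≤ M := by rw [abs_neg]; exact hMM
  set a : ℝ := t + (-(1 / 2) * κ * t ^ (2 * n + 3) + M * t ^ (2 * n + 5)) with ha
  set b : ℝ := t + (-(1 / 2) * κ * t ^ (2 * n + 3) + -M * t ^ (2 * n + 5)) with hb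
  have hda : |a - t| ≤ L * t ^ (2 * n + 3) := by rw [ha, add_sub_cancel_left]; exact hnear M hMM
  have hdb : |b - t| ≤ L * t ^ (2 * n + 3) := by
    rw [hb, add_sub_cancel_left]; exact hnear (-M) hMM'
  have hab : b ≤ a := by
    have : 0 < M * t ^ (2 * n + 5) := by positivity
    rw [ha, hb]; linarith
  have h2M : 2 * M = K + L ^ 2 + V := by rw [hM]; ring
  obtain ⟨a1, a2, a3⟩ := hdata a hda
  obtain ⟨b1, b2, b3⟩ := hdata b hdb
  have hpos := (hsign t a ht ht1 a1 a2 a3 hda).1 (by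
    have := (abs_le.1 (hexpand M hMM a ha)).1
    rw [h2M] at this
    linarith)
  have hneg := (hsign t b ht ht1 b1 b2 b3 hdb).2 (by
    have := (abs_le.1 (hexpand (-M) hMM' b hb)).2
    rw [mul_neg, h2M] at this
    linarith)
  obtain ⟨θ, hθ, hdet⟩ := exists_discreteWaveNumber (Nat.le_add_left 1 n) hh k γ hpos hneg
  rw [Set.uIcc_of_ge hab] at hθ
  obtain ⟨l1, l2⟩ := hθ
  refine ⟨θ, by linarith, hdet, ?_⟩
  rw [abs_le]
  rw [hb] at l1
  rw [ha] at l2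
  constructor <;> linarith

/-- The signed expansion of kh − θ, divided by h, is stronger than the claim; the reverse triangle
inequality passes to absolute values. -/
theorem exists_discreteWaveNumber_expansion (p : ℕ) (hp : 1 ≤ p) (γ : ℝ) :
    ∃ C₀ > (0 : ℝ), ∃ C > (0 : ℝ), ∀ k h : ℝ, 0 < k → 0 < h → k * h / p ≤ C₀ →
      ∃ k_h : ℝ, 0 < k_h ∧ IsDiscreteWaveNumber p h k γ k_h ∧
        |(|k - k_h| - 1 / 2 * |dispersionConst p + γ| * (k ^ (2 * p + 1) * h ^ (2 * p)))| ≤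
          C * (k ^ (2 * p + 3) * h ^ (2 * p + 2)) := by
  obtain ⟨n, rfl⟩ : ∃ n, p = n + 1 := ⟨p - 1, by omega⟩
  obtain ⟨t₀, ht₀, M, hM, hmain⟩ := exists_discreteWaveNumber_near n γ
  have hp0 : (0 : ℝ) < (n + 1 : ℕ) := by positivity
  refine ⟨t₀ / (n + 1 : ℕ), by positivity, M, hM, fun k h hk hh hkh => ?_⟩
  obtain ⟨θ, hθ, hdet, hest⟩ := hmain k h hh (by positivity)
    ((div_le_div_iff_of_pos_right hp0).1 hkh)
  refine ⟨θ / h, by positivity, hdet, ?_⟩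
  set κ : ℝ := dispersionConst (n + 1) + γ with hκ
  set y : ℝ := k ^ (2 * (n + 1) + 1) * h ^ (2 * (n + 1)) with hy
  have hy0 : 0 < y := by positivity
  have e1 : 1 / 2 * |κ| * y = |1 / 2 * κ * y| := by
    rw [abs_mul, abs_mul, abs_of_pos hy0, abs_of_pos (by norm_num : (0 : ℝ) < 1 / 2)]
  rw [e1]
  refine (abs_abs_sub_abs_le_abs_sub _ _).trans ?_
  have e2 : k - θ / h - 1 / 2 * κ * y =
      (k * h - θ - 1 / 2 * κ * (k * h) ^ (2 * n + 3)) / h := by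
    rw [hy, mul_pow]
    field_simp
    ring
  rw [e2, abs_div, abs_of_pos hh, div_le_iff₀ hh]
  refine hest.trans (le_of_eq ?_)
  rw [mul_pow]
  ring

end CIPFEM

end

theorem theorem3p1 (p : ℕ) (hp : 1 ≤ p) :
    (∀ γ : ℝ, ∃ C₀ > (0 : ℝ), ∃ C > (0 : ℝ), ∀ k h : ℝ, 0 < k → 0 < h → k * h / p ≤ C₀ →
      ∃ k_h : ℝ, 0 < k_h ∧ CIPFEM.IsDiscreteWaveNumber p h k γ k_h ∧
        |(|k - k_h| -
            1 / 2 * |1 / (2 * (p : ℝ) + 1) *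
                ((p.factorial : ℝ) / ((2 * p).factorial : ℝ)) ^ 2 + γ| *
              (k ^ (2 * p + 1) * h ^ (2 * p)))| ≤
          C * (k ^ (2 * p + 3) * h ^ (2 * p + 2))) ∧
    (∃ C₀ > (0 : ℝ), ∃ C > (0 : ℝ), ∀ k h : ℝ, 0 < k → 0 < h → k * h / p ≤ C₀ →
      ∃ k_h : ℝ, 0 < k_h ∧ CIPFEM.IsDiscreteWaveNumber p h k (CIPFEM.gammaZero p) k_h ∧
        |k - k_h| ≤ C * (k ^ (2 * p + 3) * h ^ (2 * p + 2))) := by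
  refine ⟨CIPFEM.exists_discreteWaveNumber_expansion p hp, ?_⟩
  obtain ⟨C₀, hC₀, C, hC, hmain⟩ :=
    CIPFEM.exists_discreteWaveNumber_expansion p hp (CIPFEM.gammaZero p)
  refine ⟨C₀, hC₀, C, hC, fun k h hk hh hkh => ?_⟩
  obtain ⟨k_h, hpos, hdet, hest⟩ := hmain k h hk hh hkh
  refine ⟨k_h, hpos, hdet, ?_⟩
  have h0 : CIPFEM.dispersionConst p + CIPFEM.gammaZero p = 0 := by
    rw [CIPFEM.dispersionConst, CIPFEM.gammaZero, add_neg_cancel]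
  rwa [h0, abs_zero, mul_zero, zero_mul, sub_zero, abs_abs] at hest
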